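/- An MV-algebra is a structure $(A,\oplus,\neg,0)$ such that $(A,\oplus,0)$ is a commutative monoid, $\neg\neg x=x$, $x\oplus 1=1$ where $1:=\neg 0$, and $\neg(\neg x\oplus y)\oplus y=\neg(\neg y\oplus x)\oplus x$. Put $x\odot y:=\neg(\neg x\oplus\neg y)$, $x\ominus y:=x\odot\neg y$, $\mathrm d(x,y):=(x\ominus y)\oplus(y\ominus x)$, and write $x\le y$ for $\neg x\oplus y=1$. A $\delta$-algebra is a structure $(A,\delta,\oplus,\neg,0)$, where $\delta$ is an operation of countably infinite arity, such that $(A,\oplus,\neg,0)$ is an MV-algebra and, with $f(x):=\delta(x,0,0,\ldots)$, the following hold for all elements of $A$: - (A1) $\mathrm d\big(\delta(x_1,x_2,\ldots),\delta(x_1,0,0,\ldots)\big)=\delta(0,x_2,x_3,\ldots)$; - (A2) $f(\delta(x_1,x_2,\ldots))=\delta(f(x_1),f(x_2),\ldots)$; - (A3) $\delta(x,x,\ldots)=x$; - (A4) $\delta(0,x_1,x_2,\ldots)=f(\delta(x_1,x_2,\ldots))$; - (A5) $\delta(x_1\oplus y_1,x_2\oplus y_2,\ldots)\ge\delta(x_1,x_2,\ldots)$;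 - (A6) $f(x\ominus y)=f(x)\ominus f(y)$. Let $\mathsf{VA}$ be the category of $\delta$-algebras and the maps preserving $\delta,\oplus,\neg,0$, and let $\mathsf{KH}$ be the category of compact Hausdorff spaces and continuous maps. Regard $[0,1]$ as a compact Hausdorff space with its Euclidean topology, and as a $\delta$-algebra with $x\oplus y=\min\{x+y,1\}$, $\neg x=1-x$ and $\delta(u_1,u_2,\ldots)=\sum_{i\ge 1}u_i/2^i$. For a compact Hausdorff space $X$, the set $\hom_{\mathsf{KH}}(X,[0,1])$ of continuous maps $X\to[0,1]$ is a $\delta$-algebra with pointwise operations; for a $\delta$-algebra $A$, the set $\hom_{\mathsf{VA}}(A,[0,1])$ with the initial topology with respect to the evaluations $h\mapsto h(a)$, $a\in A$, is a compact Hausdorff space; both act on morphisms by precomposition. **Theorem.** The contravariant functors $\hom_{\mathsf{KH}}(-,[0,1])\colon\mathsf{KH}\to\mathsf{VA}$ and $\hom_{\mathsf{VA}}(-,[0,1])\colon\mathsf{VA}\to\mathsf{KH}$ form a dual equivalence of categories. Moreover, $\mathsf{VA}$ is finitely equationally axiomatised: there is a finite set $E$ of equations between (infinitary) terms over the signature $\{\delta,\oplus,\neg,0\}$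 in countably many variables such that a structure of this signature is a $\delta$-algebra if and only if it satisfies every equation in $E$. -/

import Mathlib

open CategoryTheory

universe u v w

/-! ### The signature `(δ, ⊕, ¬, 0)` and the algebras -/

/-- The operation symbols of MV-algebras: a constant `0`, a unary `¬`, and a binary `⊕`. -/
class MVOps (A : Type u) where
  zero : A
  neg : A → A
  oplus : A → A → A

/-- The operation symbols of δ-algebras: those of MV-algebras and an operation `δ` of countably
infinite arity.  Sequences are indexed from `0`: `δ(x₁, x₂, …)` is `delta x` where `x n` is the
entry with label `n + 1`. -/
class DeltaOps (A : Type u) extends MVOps A where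
  delta : (ℕ → A) → A

namespace MVOps

variable {A : Type u} [MVOps A]

/-- The derived constant `1 := ¬ 0`. -/
def one : A := neg zero

/-- `x ⊙ y := ¬ (¬ x ⊕ ¬ y)`. -/
def odot (x y : A) : A := neg (oplus (neg x) (neg y))

/-- Truncated subtraction `x ⊖ y := x ⊙ ¬ y`. -/
def ominus (x y : A) : A := odot x (neg y)

/-- Chang's distance `d(x, y) := (x ⊖ y) ⊕ (y ⊖ x)`. -/
def dist (x y : A) : A := oplus (ominus x y) (ominus y x)

/-- The underlying order `x ≤ y`, given by the equation `¬ x ⊕ y = 1`. -/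
def le (x y : A) : Prop := oplus (neg x) y = one

end MVOps

open MVOps in
/-- MV-algebras. -/
class IsMVAlgebra (A : Type u) [MVOps A] : Prop where
  neg_neg : ∀ x : A, neg (neg x) = x
  oplus_assoc : ∀ x y z : A, oplus (oplus x y) z = oplus x (oplus y z)
  oplus_comm : ∀ x y : A, oplus x y = oplus y x
  oplus_zero : ∀ x : A, oplus x zero = x
  oplus_one : ∀ x : A, oplus x one = one
  mv_law : ∀ x y : A, oplus (neg (oplus (neg x) y)) y = oplus (neg (oplus (neg y) x)) x

/-- The sequence `a, s₀, s₁, …`. -/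
def seqCons {A : Type u} (a : A) (s : ℕ → A) : ℕ → A
  | 0 => a
  | n + 1 => s n

namespace DeltaOps

/-- The derived unary operation `f(x) := δ(x, 0, 0, …)`. -/
def half {A : Type u} [DeltaOps A] (x : A) : A := delta (seqCons x fun _ => MVOps.zero)

end DeltaOps

open MVOps DeltaOps in
/-- δ-algebras: MV-algebras with an operation `δ` subject to the six axioms A1 to A6. -/
class IsDeltaAlgebra (A : Type u) [DeltaOps A] : Prop extends IsMVAlgebra A where
  /-- A1: `d(δ(x₁, x₂, …), δ(x₁, 0, 0, …)) = δ(0, x₂, x₃, …)`. -/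
  a1 : ∀ x : ℕ → A, dist (delta x) (delta (seqCons (x 0) fun _ => zero)) =
    delta (seqCons zero fun n => x (n + 1))
  /-- A2: `f(δ(x₁, x₂, …)) = δ(f(x₁), f(x₂), …)`. -/
  a2 : ∀ x : ℕ → A, half (delta x) = delta fun n => half (x n)
  /-- A3: `δ(x, x, …) = x`. -/
  a3 : ∀ x : A, delta (fun _ => x) = x
  /-- A4: `δ(0, x₁, x₂, …) = f(δ(x₁, x₂, …))`. -/
  a4 : ∀ x : ℕ → A, delta (seqCons zero x) = half (delta x)
  /-- A5: `δ(x₁ ⊕ y₁, x₂ ⊕ y₂, …) ≥ δ(x₁, x₂, …)`. -/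
  a5 : ∀ x y : ℕ → A, le (delta x) (delta fun n => oplus (x n) (y n))
  /-- A6: `f(x ⊖ y) = f(x) ⊖ f(y)`. -/
  a6 : ∀ x y : A, half (ominus x y) = ominus (half x) (half y)

/-- Homomorphisms of δ-algebras: maps that preserve `0`, `¬`, `⊕` and `δ`. -/
@[ext]
structure DeltaHom (A : Type u) (B : Type v) [DeltaOps A] [DeltaOps B] where
  toFun : A → B
  map_zero : toFun MVOps.zero = MVOps.zero
  map_neg : ∀ x, toFun (MVOps.neg x) = MVOps.neg (toFun x)
  map_oplus : ∀ x y, toFun (MVOps.oplus x y) = MVOps.oplus (toFun x) (toFun y)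
  map_delta : ∀ x : ℕ → A, toFun (DeltaOps.delta x) = DeltaOps.delta fun n => toFun (x n)

namespace DeltaHom

/-- The identity homomorphism. -/
def id (A : Type u) [DeltaOps A] : DeltaHom A A where
  toFun := fun x => x
  map_zero := rfl
  map_neg _ := rfl
  map_oplus _ _ := rfl
  map_delta _ := rfl

/-- Composition of homomorphisms. -/
def comp {A : Type u} {B : Type v} {C : Type w} [DeltaOps A] [DeltaOps B] [DeltaOps C]
    (g : DeltaHom B C) (f : DeltaHom A B) : DeltaHom A C where
  toFun := fun x => g.toFun (f.toFun x)
  map_zero := by rw [f.map_zero, g.map_zero]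
  map_neg x := by rw [f.map_neg, g.map_neg]
  map_oplus x y := by rw [f.map_oplus, g.map_oplus]
  map_delta x := by rw [f.map_delta, g.map_delta]

end DeltaHom

/-- The category `𝖵𝖠` of δ-algebras and their homomorphisms. -/
structure DeltaAlg where
  carrier : Type u
  [ops : DeltaOps carrier]
  [isDeltaAlgebra : IsDeltaAlgebra carrier]

attribute [instance] DeltaAlg.ops DeltaAlg.isDeltaAlgebra

instance : CategoryTheory.Category DeltaAlg.{u} where
  Hom A B := DeltaHom A.carrier B.carrier
  id A := DeltaHom.id A.carrier
  comp f g := DeltaHom.comp g f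

/-! ### Infinitary terms and equations over the signature `(δ, ⊕, ¬, 0)` -/

/-- Terms in countably many variables over the signature of δ-algebras. -/
inductive DeltaTerm : Type
  | var : ℕ → DeltaTerm
  | zero : DeltaTerm
  | neg : DeltaTerm → DeltaTerm
  | oplus : DeltaTerm → DeltaTerm → DeltaTerm
  | delta : (ℕ → DeltaTerm) → DeltaTerm

/-- The value of a term in an algebra under an assignment of the variables. -/
def DeltaTerm.eval {A : Type u} [DeltaOps A] (ρ : ℕ → A) : DeltaTerm → A
  | .var n => ρ n
  | .zero => MVOps.zero
  | .neg s => MVOps.neg (s.eval ρ)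
  | .oplus s t => MVOps.oplus (s.eval ρ) (t.eval ρ)
  | .delta s => DeltaOps.delta fun n => (s n).eval ρ

/-- The algebra `A` satisfies every equation of the set `E`. -/
def SatisfiesEquations (A : Type u) [DeltaOps A] (E : Set (DeltaTerm × DeltaTerm)) : Prop :=
  ∀ e ∈ E, ∀ ρ : ℕ → A, e.1.eval ρ = e.2.eval ρ

/-! ### The δ-algebra `[0,1]` -/

namespace UnitIntervalDelta

lemma summable_half (x : ℕ → unitInterval) : Summable fun i => (x i : ℝ) / 2 ^ (i + 1) := by
  have h : Summable fun i : ℕ => (1 : ℝ) / 2 ^ (i + 1) :=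
    (summable_geometric_two' 1).congr fun i => by rw [pow_succ, div_div, mul_comm]
  exact Summable.of_nonneg_of_le (fun i => div_nonneg (x i).2.1 (by positivity))
    (fun i => by gcongr; exact (x i).2.2) h

lemma tsum_one : ∑' i : ℕ, (1 : ℝ) / 2 ^ (i + 1) = 1 := by
  refine Eq.trans ?_ (tsum_geometric_two' (1 : ℝ))
  exact tsum_congr fun i => by rw [pow_succ', div_div]

lemma tsum_mem (x : ℕ → unitInterval) :
    ∑' i, (x i : ℝ) / 2 ^ (i + 1) ∈ unitInterval := by
  refine ⟨tsum_nonneg fun i => div_nonneg (x i).2.1 (by positivity), ?_⟩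
  rw [← tsum_one]
  refine (summable_half x).tsum_le_tsum (fun i => ?_) (by simpa using summable_half fun _ => 1)
  gcongr
  exact (x i).2.2

end UnitIntervalDelta

/-- The operations of the unit interval: `x ⊕ y = min (x + y) 1`, `¬ x = 1 - x`, and
`δ(u₁, u₂, …) = ∑ uᵢ / 2ⁱ`. -/
noncomputable instance : DeltaOps unitInterval where
  zero := 0
  neg x := ⟨1 - (x : ℝ), by linarith [x.2.2], by linarith [x.2.1]⟩
  oplus x y := ⟨min ((x : ℝ) + y) 1, le_min (add_nonneg x.2.1 y.2.1) zero_le_one, min_le_right _ _⟩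
  delta x := ⟨∑' i, (x i : ℝ) / 2 ^ (i + 1), UnitIntervalDelta.tsum_mem x⟩

namespace UnitIntervalDelta

open MVOps DeltaOps

lemma coe_zero : ((zero : unitInterval) : ℝ) = 0 := rfl
lemma coe_neg (x : unitInterval) : ((neg x : unitInterval) : ℝ) = 1 - x := rfl
lemma coe_oplus (x y : unitInterval) : ((oplus x y : unitInterval) : ℝ) = min ((x : ℝ) + y) 1 := rfl
lemma coe_delta (x : ℕ → unitInterval) :
    ((delta x : unitInterval) : ℝ) = ∑' i, (x i : ℝ) / 2 ^ (i + 1) := rfl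
lemma coe_one : ((one : unitInterval) : ℝ) = 1 := by simp [one, coe_neg, coe_zero]

lemma coe_ominus (x y : unitInterval) :
    ((ominus x y : unitInterval) : ℝ) = max ((x : ℝ) - y) 0 := by
  simp only [ominus, odot, coe_neg, coe_oplus]
  rcases le_total ((x : ℝ) - y) 0 with h | h
  · rw [max_eq_right h, min_eq_right (by linarith)]; ring
  · rw [max_eq_left h, min_eq_left (by linarith)]; ring

lemma coe_delta_cons (a : unitInterval) (x : ℕ → unitInterval) :
    ((delta (seqCons a x) : unitInterval) : ℝ) = (a : ℝ) / 2 + (delta x : unitInterval) / 2 := by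
  rw [coe_delta, coe_delta, (summable_half _).tsum_eq_zero_add, ← tsum_div_const]
  congr 1
  · simp [seqCons]
  · exact tsum_congr fun i => by rw [div_div, ← pow_succ]; rfl

lemma coe_delta_zero : ((delta (fun _ => zero) : unitInterval) : ℝ) = 0 := by
  simp [coe_delta, coe_zero]

lemma coe_half (a : unitInterval) : ((half a : unitInterval) : ℝ) = (a : ℝ) / 2 := by
  rw [half, coe_delta_cons, coe_delta_zero]; ring

lemma seqCons_eta (x : ℕ → unitInterval) : seqCons (x 0) (fun n => x (n + 1)) = x := by
  funext n; cases n <;> rfl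

lemma continuous_neg : Continuous (neg : unitInterval → unitInterval) :=
  Continuous.subtype_mk (by fun_prop) _

lemma continuous_oplus : Continuous fun p : unitInterval × unitInterval => oplus p.1 p.2 :=
  Continuous.subtype_mk (by fun_prop) _

lemma continuous_delta : Continuous (delta : (ℕ → unitInterval) → unitInterval) := by
  refine Continuous.subtype_mk (continuous_tsum (u := fun i : ℕ => (1 : ℝ) / 2 ^ (i + 1))
    (fun i => by fun_prop) (by simpa using summable_half fun _ => 1) fun i x => ?_) _
  rw [Real.norm_of_nonneg (div_nonneg (x i).2.1 (by positivity))]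
  gcongr
  exact (x i).2.2

end UnitIntervalDelta

open UnitIntervalDelta in
instance : IsDeltaAlgebra unitInterval where
  neg_neg x := by ext; simp [coe_neg]
  oplus_assoc x y z := by
    ext
    simp only [coe_oplus]
    have := x.2.1
    have := z.2.1
    rcases le_total ((x : ℝ) + y) 1 with h | h <;> rcases le_total ((y : ℝ) + z) 1 with h' | h'
    · rw [min_eq_left h, min_eq_left h', add_assoc]
    · rw [min_eq_left h, min_eq_right h', min_eq_right, min_eq_right] <;> linarith
    · rw [min_eq_right h, min_eq_left h', min_eq_right, min_eq_right] <;> linarith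
    · rw [min_eq_right h, min_eq_right h', min_eq_right, min_eq_right] <;> linarith
  oplus_comm x y := by ext; simp only [coe_oplus, add_comm]
  oplus_zero x := by ext; simp [coe_oplus, coe_zero, x.2.2]
  oplus_one x := by ext; simp [coe_oplus, coe_one, x.2.1]
  mv_law x y := by
    ext
    simp only [coe_oplus, coe_neg]
    have := x.2.2
    have := y.2.2
    rcases le_total (x : ℝ) y with h | h
    · rw [min_eq_right (a := 1 - (x : ℝ) + y) (by linarith),
        min_eq_left (a := 1 - (y : ℝ) + x) (by linarith), min_eq_left (by linarith),
        min_eq_left (by linarith)]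
      ring
    · rw [min_eq_left (a := 1 - (x : ℝ) + y) (by linarith),
        min_eq_right (a := 1 - (y : ℝ) + x) (by linarith), min_eq_left (by linarith),
        min_eq_left (by linarith)]
      ring
  a1 x := by
    ext
    have hx : ((DeltaOps.delta x : unitInterval) : ℝ) =
        (x 0 : ℝ) / 2 + (DeltaOps.delta fun n => x (n + 1) : unitInterval) / 2 := by
      rw [← coe_delta_cons, seqCons_eta]
    have h := (DeltaOps.delta fun n => x (n + 1) : unitInterval).2
    simp only [MVOps.dist, coe_oplus, coe_ominus, coe_delta_cons, coe_delta_zero, hx, coe_zero]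
    rw [max_eq_left (by linarith [h.1]), max_eq_right (by linarith [h.1]),
      min_eq_left (by linarith [h.2])]
    ring
  a2 x := by
    ext
    simp only [coe_half, coe_delta, ← tsum_div_const]
    exact tsum_congr fun i => div_right_comm _ _ _
  a3 x := by
    ext
    have : ∀ i : ℕ, (x : ℝ) / 2 ^ (i + 1) = x * (1 / 2 ^ (i + 1)) := fun i => by ring
    simp only [coe_delta, this]
    rw [tsum_mul_left, tsum_one, mul_one]
  a4 x := by
    ext
    simp [coe_delta_cons, coe_half, coe_zero]
  a5 x y := by
    have h : ((DeltaOps.delta x : unitInterval) : ℝ) ≤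
        (DeltaOps.delta fun n => MVOps.oplus (x n) (y n) : unitInterval) := by
      simp only [coe_delta]
      refine (summable_half x).tsum_le_tsum (fun i => ?_) (summable_half _)
      gcongr
      exact le_min (le_add_of_nonneg_right (y i).2.1) (x i).2.2
    refine Subtype.ext ?_
    rw [coe_one, coe_oplus, coe_neg]
    exact min_eq_right (by linarith)
  a6 x y := by
    ext
    simp only [coe_half, coe_ominus]
    rw [← sub_div, ← zero_div (2 : ℝ), max_div_div_right (by norm_num), zero_div]

/-! ### The δ-algebra of continuous functions `X → [0,1]` -/

/-- The pointwise operations on `[0,1]`-valued continuous functions. -/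
noncomputable instance (X : Type u) [TopologicalSpace X] : DeltaOps C(X, unitInterval) where
  zero := ContinuousMap.const X MVOps.zero
  neg f := ⟨fun t => MVOps.neg (f t), UnitIntervalDelta.continuous_neg.comp f.continuous⟩
  oplus f g := ⟨fun t => MVOps.oplus (f t) (g t),
    UnitIntervalDelta.continuous_oplus.comp (f.continuous.prodMk g.continuous)⟩
  delta f := ⟨fun t => DeltaOps.delta fun n => f n t,
    UnitIntervalDelta.continuous_delta.comp (continuous_pi fun n => (f n).continuous)⟩

lemma seqCons_apply {X : Type u} [TopologicalSpace X] (a : C(X, unitInterval))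
    (s : ℕ → C(X, unitInterval)) (t : X) :
    (fun n => seqCons a s n t) = seqCons (a t) fun n => s n t := by
  funext n; cases n <;> rfl

lemma half_apply {X : Type u} [TopologicalSpace X] (a : C(X, unitInterval)) (t : X) :
    DeltaOps.half a t = DeltaOps.half (a t) :=
  congrArg DeltaOps.delta (seqCons_apply a _ t)

instance (X : Type u) [TopologicalSpace X] : IsDeltaAlgebra C(X, unitInterval) where
  neg_neg f := ContinuousMap.ext fun t => IsMVAlgebra.neg_neg (f t)
  oplus_assoc f g h := ContinuousMap.ext fun t => IsMVAlgebra.oplus_assoc (f t) (g t) (h t)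
  oplus_comm f g := ContinuousMap.ext fun t => IsMVAlgebra.oplus_comm (f t) (g t)
  oplus_zero f := ContinuousMap.ext fun t => IsMVAlgebra.oplus_zero (f t)
  oplus_one f := ContinuousMap.ext fun t => IsMVAlgebra.oplus_one (f t)
  mv_law f g := ContinuousMap.ext fun t => IsMVAlgebra.mv_law (f t) (g t)
  a1 f := ContinuousMap.ext fun t => by
    change MVOps.dist (DeltaOps.delta fun n => f n t)
      (DeltaOps.delta fun n => seqCons (f 0) (fun _ => MVOps.zero) n t) =
      DeltaOps.delta fun n => seqCons MVOps.zero (fun n => f (n + 1)) n t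
    rw [seqCons_apply, seqCons_apply]
    exact IsDeltaAlgebra.a1 fun n => f n t
  a2 f := ContinuousMap.ext fun t => by
    change DeltaOps.half (DeltaOps.delta f) t = DeltaOps.delta fun n => DeltaOps.half (f n) t
    simp only [half_apply]
    exact IsDeltaAlgebra.a2 fun n => f n t
  a3 f := ContinuousMap.ext fun t => IsDeltaAlgebra.a3 (f t)
  a4 f := ContinuousMap.ext fun t => by
    change (DeltaOps.delta fun n => seqCons MVOps.zero f n t) = DeltaOps.half (DeltaOps.delta f) t
    rw [seqCons_apply, half_apply]
    exact IsDeltaAlgebra.a4 fun n => f n t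
  a5 f g := ContinuousMap.ext fun t => IsDeltaAlgebra.a5 (fun n => f n t) fun n => g n t
  a6 f g := ContinuousMap.ext fun t => by
    change DeltaOps.half (MVOps.ominus f g) t =
      MVOps.ominus (DeltaOps.half f t) (DeltaOps.half g t)
    simp only [half_apply]
    exact IsDeltaAlgebra.a6 (f t) (g t)

/-- Precomposition with a continuous map is a homomorphism of δ-algebras. -/
noncomputable def ContinuousMap.precompDeltaHom {X : Type u} {Y : Type v} [TopologicalSpace X]
    [TopologicalSpace Y] (f : C(X, Y)) : DeltaHom C(Y, unitInterval) C(X, unitInterval) where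
  toFun g := g.comp f
  map_zero := rfl
  map_neg _ := rfl
  map_oplus _ _ := rfl
  map_delta _ := rfl

/-- The contravariant functor `hom(-, [0,1])` from compact Hausdorff spaces to δ-algebras. -/
noncomputable def homKH : CompHaus.{u}ᵒᵖ ⥤ DeltaAlg.{u} where
  obj X := ⟨C(X.unop, unitInterval)⟩
  map f := ContinuousMap.precompDeltaHom (ConcreteCategory.hom f.unop)
  map_id _ := rfl
  map_comp _ _ := rfl

/-! ### The compact Hausdorff space of homomorphisms `A → [0,1]` -/

/-- The initial topology with respect to the evaluations `h ↦ h(a)`, `a ∈ A`. -/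
instance (A : Type u) [DeltaOps A] : TopologicalSpace (DeltaHom A unitInterval) :=
  ⨅ a : A, TopologicalSpace.induced (fun h => h.toFun a) inferInstance

namespace DeltaHom

variable {A : Type u} [DeltaOps A]

lemma isInducing_toFun :
    Topology.IsInducing (DeltaHom.toFun : DeltaHom A unitInterval → A → unitInterval) := by
  refine ⟨?_⟩
  change _ = TopologicalSpace.induced _ (⨅ a : A, _)
  rw [induced_iInf]
  simp only [induced_compose]
  rfl

lemma continuous_eval (a : A) : Continuous fun h : DeltaHom A unitInterval => h.toFun a :=
  (continuous_apply a).comp isInducing_toFun.continuous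

open UnitIntervalDelta in
lemma isClosedEmbedding_toFun :
    Topology.IsClosedEmbedding (DeltaHom.toFun : DeltaHom A unitInterval → A → unitInterval) := by
  refine ⟨⟨isInducing_toFun, fun g h e => DeltaHom.ext e⟩, ?_⟩
  have : Set.range (DeltaHom.toFun : DeltaHom A unitInterval → A → unitInterval) =
      {f | f MVOps.zero = MVOps.zero} ∩ {f | ∀ x, f (MVOps.neg x) = MVOps.neg (f x)} ∩
      {f | ∀ x y, f (MVOps.oplus x y) = MVOps.oplus (f x) (f y)} ∩
      {f | ∀ x : ℕ → A, f (DeltaOps.delta x) = DeltaOps.delta fun n => f (x n)} := by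
    ext f
    constructor
    · rintro ⟨h, rfl⟩
      exact ⟨⟨⟨h.map_zero, h.map_neg⟩, h.map_oplus⟩, h.map_delta⟩
    · rintro ⟨⟨⟨h0, h1⟩, h2⟩, h3⟩
      exact ⟨⟨f, h0, h1, h2, h3⟩, rfl⟩
  rw [this]
  simp only [Set.ofPred_forall]
  refine IsClosed.inter (IsClosed.inter (IsClosed.inter ?_ ?_) ?_) ?_
  · exact isClosed_eq (continuous_apply _) continuous_const
  · exact isClosed_iInter fun x =>
      isClosed_eq (continuous_apply _) (continuous_neg.comp (continuous_apply x))
  · exact isClosed_iInter fun x => isClosed_iInter fun y => isClosed_eq (continuous_apply _)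
      (continuous_oplus.comp₂ (continuous_apply x) (continuous_apply y))
  · exact isClosed_iInter fun x => isClosed_eq (continuous_apply _)
      (continuous_delta.comp (continuous_pi fun n => continuous_apply (x n)))

instance : CompactSpace (DeltaHom A unitInterval) := isClosedEmbedding_toFun.compactSpace

instance : T2Space (DeltaHom A unitInterval) := isClosedEmbedding_toFun.isEmbedding.t2Space

/-- Precomposition with a homomorphism of δ-algebras, as a continuous map. -/
noncomputable def precompContinuousMap {B : Type v} [DeltaOps B] (f : DeltaHom A B) :
    C(DeltaHom B unitInterval, DeltaHom A unitInterval) where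
  toFun h := h.comp f
  continuous_toFun :=
    isInducing_toFun.continuous_iff.2 (continuous_pi fun a => continuous_eval (f.toFun a))

end DeltaHom

/-- The contravariant functor `hom(-, [0,1])` from δ-algebras to compact Hausdorff spaces. -/
noncomputable def homVA : DeltaAlg.{u}ᵒᵖ ⥤ CompHaus.{u} where
  obj A := CompHaus.of (DeltaHom A.unop.carrier unitInterval)
  map f := CompHausLike.ofHom _ (DeltaHom.precompContinuousMap f.unop)
  map_id _ := rfl
  map_comp _ _ := rfl

/-!
# Compact Hausdorff spaces are dual to δ-algebras

For a δ-algebra `A` with space of homomorphisms `Y = hom(A, [0,1])`, the point is that evaluation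
`A → C(Y, [0,1])` is bijective; that `X → hom(C(X, [0,1]), [0,1])` is bijective for a compact
Hausdorff space `X` is the usual compactness argument (`DeltaAlgebra.pointHomMap_surjective`) and
Urysohn's lemma.

*Injectivity.* An MV-algebra is a canonically ordered additive monoid with `⊖` as its truncated
subtraction, and prelinearity `(x ⊖ y) ∧ (y ⊖ x) = 0` makes an ideal that is maximal among those
avoiding a given element prime (`MVAlgebra.exists_prime_ideal`). In a δ-algebra, `f` halves
elements, so `A` contains the dyadic constants `k / 2ⁿ`; comparing an element with them modulo a
proper prime ideal yields an MV-homomorphism to `[0,1]` (`DeltaAlgebra.exists_hom_of_prime`), and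
this preserves `δ` because it preserves all partial sums (`DeltaAlgebra.homOfMVHom`). What such
homomorphisms could fail to detect are infinitesimals, and there are none: if `a ≤ 2⁻ⁿ` for all
`n`, then `s = δ(2a, 4a, 8a, …)` is the sum of infinitely many copies of `a`, so `s ⊖ a = s`, which
forces `a = 0` (`DeltaAlgebra.eq_zero_of_forall_le_halfPow`).

*Surjectivity.* The image of `A` is a lattice that separates points, so it is dense by the
Stone–Weierstrass theorem (`DeltaAlgebra.exists_forall_abs_sub_le`). Density provides every
continuous `g : Y → [0,1]` with a digit `u` in `A` such that `2 g - u` again has values in `[0,1]`;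
iterating, `g` is the value of `δ` at its sequence of digits, without any completeness argument
(`DeltaAlgebra.evalDeltaHom_surjective`).

The axioms are equations as they stand, since `x ≤ y` abbreviates the equation `¬ x ⊕ y = 1`.
-/

/-! ### MV-algebras as ordered monoids; prime ideals -/

namespace MVAlgebra

open MVOps (neg one)

section Order

variable {A : Type u} [MVOps A] [IsMVAlgebra A]

/-- The additive monoid `(A, ⊕, 0)`. -/
abbrev addCommMonoid : AddCommMonoid A where
  add := MVOps.oplus
  zero := MVOps.zero
  add_assoc := IsMVAlgebra.oplus_assoc
  add_comm := IsMVAlgebra.oplus_comm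
  add_zero := IsMVAlgebra.oplus_zero
  zero_add x := (IsMVAlgebra.oplus_comm _ _).trans (IsMVAlgebra.oplus_zero x)
  nsmul := @nsmulRec A ⟨MVOps.zero⟩ ⟨MVOps.oplus⟩

attribute [local instance] addCommMonoid

/-- Truncated subtraction `⊖` as subtraction. -/
abbrev sub : Sub A := ⟨MVOps.ominus⟩

attribute [local instance] sub

lemma neg_neg (x : A) : neg (neg x) = x := IsMVAlgebra.neg_neg x

lemma sub_eq (x y : A) : x - y = neg (neg x + y) := by
  change neg (neg x + neg (neg y)) = _
  rw [neg_neg]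

lemma neg_sub (x y : A) : neg (x - y) = neg x + y := by rw [sub_eq, neg_neg]

lemma neg_zero : neg (0 : A) = one := rfl

lemma neg_one : neg (one : A) = 0 := neg_neg 0

lemma add_one (x : A) : x + one = one := IsMVAlgebra.oplus_one x

lemma one_add (x : A) : one + x = one := (add_comm _ _).trans (add_one x)

/-- Both sides are the join of `x` and `y`. -/
lemma sub_add_comm (x y : A) : x - y + y = y - x + x := by
  rw [sub_eq, sub_eq]
  exact IsMVAlgebra.mv_law x y

lemma neg_add_self (x : A) : neg x + x = one := by
  have h := sub_add_comm x one
  rwa [add_one, sub_eq, neg_one, zero_add, eq_comm] at h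

lemma sub_add_of_le {x y : A} (h : MVOps.le x y) : y - x + x = y := by
  have h' : neg x + y = one := h
  rw [sub_add_comm, sub_eq, h', neg_one, zero_add]

lemma le_add (x z : A) : MVOps.le x (x + z) := by
  change neg x + (x + z) = one
  rw [← add_assoc, neg_add_self, one_add]

lemma sub_le_iff (x y z : A) : MVOps.le (x - y) z ↔ MVOps.le x (z + y) := by
  change neg (x - y) + z = one ↔ neg x + (z + y) = one
  rw [neg_sub, add_assoc, add_comm y z]

/-- The underlying order `¬ x ⊕ y = 1` of an MV-algebra. -/
abbrev partialOrder : PartialOrder A where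
  le := MVOps.le
  le_refl := neg_add_self
  le_trans x y z hxy hyz := by
    rw [← sub_add_of_le hyz, ← sub_add_of_le hxy, add_comm (y - x), add_comm, add_assoc]
    exact le_add _ _
  le_antisymm x y hxy hyx := by
    rw [← sub_add_of_le hxy, ← sub_add_comm, sub_add_of_le hyx]

attribute [local instance] partialOrder

lemma neg_le_neg {x y : A} (h : x ≤ y) : neg y ≤ neg x := by
  change neg (neg y) + neg x = one
  rw [neg_neg, add_comm]
  exact h

theorem isOrderedAddMonoid : IsOrderedAddMonoid A where
  add_le_add_left x y h z := by
    rw [← sub_add_of_le h, add_assoc, add_comm (y - x)]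
    exact le_add (x + z) _

theorem canonicallyOrderedAdd : CanonicallyOrderedAdd A where
  exists_add_of_le {x y} h := ⟨y - x, (sub_add_of_le h).symm.trans (add_comm _ _)⟩
  le_self_add := le_add
  le_add_self x y := by rw [add_comm]; exact le_add x y

theorem orderedSub : OrderedSub A := ⟨sub_le_iff⟩

attribute [local instance] isOrderedAddMonoid canonicallyOrderedAdd orderedSub

/-- The lattice structure of an MV-algebra, `x ∨ y = (x ⊖ y) ⊕ y` and `x ∧ y = ¬(¬x ∨ ¬y)`. -/
abbrev lattice : Lattice A where
  toPartialOrder := partialOrder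
  sup x y := x - y + y
  inf x y := neg (neg x - neg y + neg y)
  le_sup_left x y := by rw [sub_add_comm]; exact le_add_self
  le_sup_right x y := le_add_self
  sup_le x y z hx hy := by
    calc x - y + y ≤ z - y + y := by gcongr
      _ = z := sub_add_of_le hy
  inf_le_left x y := by
    rw [sub_add_comm]
    conv_rhs => rw [← neg_neg x]
    exact neg_le_neg le_add_self
  inf_le_right x y := by
    conv_rhs => rw [← neg_neg y]
    exact neg_le_neg le_add_self
  le_inf x y z hy hz := by
    rw [← neg_neg x]
    refine neg_le_neg ?_
    calc neg y - neg z + neg z ≤ neg x - neg z + neg z := by gcongr; exact neg_le_neg hy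
      _ = neg x := sub_add_of_le (neg_le_neg hz)

attribute [local instance] lattice

lemma le_one (x : A) : x ≤ one := add_one _

lemma one_sub (x : A) : one - x = neg x := by rw [sub_eq, neg_one, zero_add]

lemma neg_add (x y : A) : neg (x + y) = neg x - y := by rw [sub_eq, neg_neg]

lemma neg_sub_neg (x y : A) : neg x - neg y = y - x := by
  rw [sub_eq, sub_eq, neg_neg, add_comm]

lemma le_neg_comm {x y : A} : x ≤ neg y ↔ y ≤ neg x := by
  constructor <;> intro h <;> simpa only [neg_neg] using neg_le_neg h

/-- Cancellation holds when the truncated sum is not truncated. -/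
lemma add_sub_cancel_of_le_neg {x y : A} (h : y ≤ neg x) : x + y - x = y := by
  rw [sub_eq, add_comm x y, neg_add y x, tsub_add_cancel_of_le (le_neg_comm.1 h), neg_neg]

lemma sub_inf_self (x y : A) : (x - y) ⊓ (y - x) = 0 := by
  have hxy : ∀ x y : A, x - y = x - x ⊓ y := fun x y => by
    refine le_antisymm (tsub_le_tsub_left inf_le_right _) ?_
    have h : neg (x ⊓ y) = neg x ⊔ neg y := neg_neg _
    rw [← neg_sub_neg, h, tsub_le_iff_right]
    refine sup_le le_add_self ?_
    rw [← neg_sub_neg, ← tsub_le_iff_right]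
  rw [hxy x y, hxy y x, inf_comm y x]
  set m := x ⊓ y with hm
  set w := (x - m) ⊓ (y - m) with hw
  have hmw : m + w ≤ m := by
    refine le_inf ?_ ?_
    · calc m + w ≤ m + (x - m) := by gcongr; exact inf_le_left
        _ = x := add_tsub_cancel_of_le inf_le_left
    · calc m + w ≤ m + (y - m) := by gcongr; exact inf_le_right
        _ = y := add_tsub_cancel_of_le inf_le_right
  have h1 : w ≤ neg m := by
    rw [← one_sub]
    exact inf_le_left.trans (tsub_le_tsub_right (le_one x) _)
  rw [← add_sub_cancel_of_le_neg h1]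
  exact tsub_eq_zero_of_le hmw

lemma inf_add_eq_zero {x y z : A} (hy : x ⊓ y = 0) (hz : x ⊓ z = 0) : x ⊓ (y + z) = 0 := by
  have h : x ⊓ (y + z) - y ≤ x ⊓ z :=
    le_inf (tsub_le_self.trans inf_le_left) (tsub_le_iff_left.2 inf_le_right)
  rw [hz, nonpos_iff_eq_zero, tsub_eq_zero_iff_le] at h
  exact nonpos_iff_eq_zero.1 (hy ▸ le_inf inf_le_left h)

lemma inf_nsmul_eq_zero {x y : A} (h : x ⊓ y = 0) (n : ℕ) : x ⊓ n • y = 0 := by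
  induction n with
  | zero => rw [zero_nsmul]; exact inf_eq_right.2 (zero_le)
  | succ n ih => rw [succ_nsmul]; exact inf_add_eq_zero ih h

/-- Ideals of an MV-algebra: lower sets that contain `0` and are closed under `⊕`. -/
structure IsIdeal (I : Set A) : Prop where
  zero_mem : 0 ∈ I
  add_mem : ∀ ⦃x y⦄, x ∈ I → y ∈ I → x + y ∈ I
  mem_of_le : ∀ ⦃x y⦄, x ≤ y → y ∈ I → x ∈ I

lemma IsIdeal.nsmul_mem {I : Set A} (hI : IsIdeal I) {x : A} (hx : x ∈ I) (n : ℕ) :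
    n • x ∈ I := by
  induction n with
  | zero => rw [zero_nsmul]; exact hI.zero_mem
  | succ n ih => rw [succ_nsmul]; exact hI.add_mem ih hx

/-- The ideal generated by an ideal `I` and an element `x`. -/
lemma IsIdeal.adjoin {I : Set A} (hI : IsIdeal I) (x : A) :
    IsIdeal {z | ∃ p ∈ I, ∃ n : ℕ, z ≤ p + n • x} where
  zero_mem := ⟨0, hI.zero_mem, 0, zero_le⟩
  add_mem := by
    rintro y z ⟨p, hp, m, hy⟩ ⟨q, hq, n, hz⟩
    refine ⟨p + q, hI.add_mem hp hq, m + n, ?_⟩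
    rw [add_nsmul, add_add_add_comm]
    gcongr
  mem_of_le := by
    rintro y z hyz ⟨p, hp, m, hz⟩
    exact ⟨p, hp, m, hyz.trans hz⟩

/-- An ideal that is maximal among those that avoid `a` is prime, because `x ⊖ y` and `y ⊖ x`
are disjoint. -/
theorem exists_prime_ideal {a : A} (ha : a ≠ 0) :
    ∃ P : Set A, IsIdeal P ∧ a ∉ P ∧ ∀ x y : A, x - y ∈ P ∨ y - x ∈ P := by
  have h0 : ({0} : Set A) ∈ {I : Set A | IsIdeal I ∧ a ∉ I} :=
    ⟨⟨rfl, fun x y hx hy => by rw [hx, hy]; exact add_zero _,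
      fun x y h hy => nonpos_iff_eq_zero.1 (h.trans_eq hy)⟩, ha⟩
  obtain ⟨P, -, hP⟩ := zorn_subset_nonempty {I : Set A | IsIdeal I ∧ a ∉ I}
    (fun c hc hchain hne => by
      refine ⟨⋃₀ c, ⟨⟨?_, ?_, ?_⟩, ?_⟩, fun s hs => Set.subset_sUnion_of_mem hs⟩
      · obtain ⟨s, hs⟩ := hne
        exact ⟨s, hs, (hc hs).1.zero_mem⟩
      · rintro x y ⟨s, hs, hx⟩ ⟨t, ht, hy⟩
        rcases hchain.total hs ht with h | h
        · exact ⟨t, ht, (hc ht).1.add_mem (h hx) hy⟩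
        · exact ⟨s, hs, (hc hs).1.add_mem hx (h hy)⟩
      · rintro x y hxy ⟨s, hs, hy⟩
        exact ⟨s, hs, (hc hs).1.mem_of_le hxy hy⟩
      · rintro ⟨s, hs, h⟩
        exact (hc hs).2 h) _ h0
  obtain ⟨hPI, haP⟩ := hP.prop
  refine ⟨P, hPI, haP, fun x y => ?_⟩
  have key : ∀ z, z ∉ P → ∃ p ∈ P, ∃ n : ℕ, a ≤ p + n • z := fun z hz => by
    by_contra hcon
    refine hz (hP.le_of_ge ⟨hPI.adjoin z, hcon⟩
      (fun p hp => ⟨p, hp, 0, le_self_add⟩) ⟨0, hPI.zero_mem, 1, ?_⟩)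
    rw [one_nsmul]
    exact le_add_self
  by_contra! hcon
  obtain ⟨p, hp, m, h1⟩ := key _ hcon.1
  obtain ⟨q, hq, n, h2⟩ := key _ hcon.2
  refine haP (hPI.mem_of_le ?_ (hPI.add_mem hp hq))
  have hmn : m • (x - y) ⊓ n • (y - x) = 0 := by
    refine inf_nsmul_eq_zero ?_ _
    rw [inf_comm]
    refine inf_nsmul_eq_zero ?_ _
    rw [inf_comm]
    exact sub_inf_self x y
  rw [← tsub_eq_zero_iff_le, ← nonpos_iff_eq_zero, ← hmn]
  refine le_inf (tsub_le_iff_left.2 (h1.trans ?_)) (tsub_le_iff_left.2 (h2.trans ?_)) <;> gcongr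
  · exact le_self_add
  · exact le_add_self

end Order

end MVAlgebra

namespace DeltaAlgebra

open MVOps (neg one oplus ominus)
open DeltaOps (delta half)
open MVAlgebra (IsIdeal)

/-! ### Halving, infinitesimals and dyadic constants -/

section Halving

/-- The constant `2⁻ⁿ` of a δ-algebra. -/
def halfPow (A : Type u) [DeltaOps A] (n : ℕ) : A := half^[n] one

lemma halfPow_succ {A : Type u} [DeltaOps A] (n : ℕ) :
    halfPow A (n + 1) = half (halfPow A n) :=
  Function.iterate_succ_apply' _ _ _

variable {A : Type u} [DeltaOps A] [IsDeltaAlgebra A]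

attribute [local instance] MVAlgebra.addCommMonoid MVAlgebra.sub MVAlgebra.lattice
  MVAlgebra.isOrderedAddMonoid MVAlgebra.canonicallyOrderedAdd MVAlgebra.orderedSub

lemma delta_mono {x y : ℕ → A} (h : ∀ n, x n ≤ y n) : delta x ≤ delta y := by
  have h5 : delta x ≤ delta fun n => x n + (y n - x n) := IsDeltaAlgebra.a5 x fun n => y n - x n
  simpa only [add_tsub_cancel_of_le (h _)] using h5

lemma half_le_delta (x : ℕ → A) : half (x 0) ≤ delta x :=
  delta_mono fun n => by
    cases n
    · exact le_rfl
    · exact zero_le (a := x _)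

lemma delta_sub_half (x : ℕ → A) : delta x - half (x 0) = half (delta fun n => x (n + 1)) := by
  rw [← IsDeltaAlgebra.a4, ← IsDeltaAlgebra.a1]
  change _ = (delta x - half (x 0)) + (half (x 0) - delta x)
  rw [tsub_eq_zero_of_le (half_le_delta x), add_zero]

lemma delta_eq_half_add_half (x : ℕ → A) :
    delta x = half (x 0) + half (delta fun n => x (n + 1)) := by
  rw [← delta_sub_half, add_tsub_cancel_of_le (half_le_delta x)]

lemma half_le (x : A) : half x ≤ x := by
  simpa only [IsDeltaAlgebra.a3] using half_le_delta fun _ => x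

lemma sub_half (x : A) : x - half x = half x := by
  simpa only [IsDeltaAlgebra.a3] using delta_sub_half fun _ => x

lemma half_add_half (x : A) : half x + half x = x := by
  nth_rewrite 1 [← sub_half x]
  exact tsub_add_cancel_of_le (half_le x)

lemma half_mono {x y : A} (h : x ≤ y) : half x ≤ half y := by
  rw [← tsub_eq_zero_iff_le]
  refine (IsDeltaAlgebra.a6 x y).symm.trans ?_
  have h0 : MVOps.ominus x y = (0 : A) := tsub_eq_zero_of_le h
  rw [h0]
  exact nonpos_iff_eq_zero.1 (half_le 0)

lemma half_add_self {x : A} (h : x ≤ neg x) : half (x + x) = x := by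
  have h1 : half (x + x) - half x = half x := by
    refine (IsDeltaAlgebra.a6 _ x).symm.trans ?_
    exact congrArg half (MVAlgebra.add_sub_cancel_of_le_neg h)
  rw [← tsub_add_cancel_of_le (half_mono (le_self_add : x ≤ x + x)), h1, half_add_half]

lemma two_pow_nsmul_halfPow (n m : ℕ) : 2 ^ m • halfPow A (n + m) = halfPow A n := by
  induction m with
  | zero => rw [pow_zero, one_nsmul, add_zero]
  | succ m ih =>
    rw [pow_succ, mul_nsmul, two_nsmul, ← nsmul_add, ← add_assoc n, halfPow_succ, half_add_half, ih]

lemma two_pow_nsmul_halfPow_self (n : ℕ) : 2 ^ n • halfPow A n = one := by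
  have h := two_pow_nsmul_halfPow (A := A) 0 n
  rwa [zero_add] at h

lemma neg_halfPow_one : neg (halfPow A 1) = halfPow A 1 := by
  rw [← MVAlgebra.one_sub, halfPow_succ]
  exact sub_half one

/-- δ-algebras have no infinitesimals: if `a ≤ 2⁻ⁿ` for all `n`, then the element
`s = δ(2a, 4a, 8a, …)`, in which `a` is added up infinitely often, satisfies `s ⊖ a = s`. -/
theorem eq_zero_of_forall_le_halfPow {a : A} (h : ∀ n, a ≤ halfPow A n) : a = 0 := by
  have hle : ∀ n, 2 ^ n • a ≤ neg (2 ^ n • a) := fun n => by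
    have h1 : 2 ^ n • a ≤ halfPow A 1 := by
      rw [← two_pow_nsmul_halfPow 1 n]
      exact nsmul_le_nsmul_right (h _) _
    exact h1.trans (neg_halfPow_one.symm.trans_le (MVAlgebra.neg_le_neg h1))
  have hhalf : ∀ n, half (2 ^ (n + 1) • a) = 2 ^ n • a := fun n => by
    rw [pow_succ, mul_nsmul, two_nsmul, half_add_self (hle n)]
  set s : A := delta fun n => 2 ^ (n + 1) • a with hs
  have h1 : s - a = s := by
    have h2 := delta_sub_half fun n => 2 ^ (n + 1) • a
    simp only [hhalf, IsDeltaAlgebra.a2] at h2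
    rwa [pow_zero, one_nsmul] at h2
  have h2 : a ≤ neg s := by
    rw [← h1, MVAlgebra.neg_sub]
    exact le_add_self
  have h3 : a ≤ s := by
    have := half_le_delta fun n => 2 ^ (n + 1) • a
    rwa [hhalf, pow_zero, one_nsmul] at this
  rw [← MVAlgebra.add_sub_cancel_of_le_neg h2]
  conv_lhs => rw [← h1, tsub_add_cancel_of_le h3, h1]
  exact tsub_self s

/-- As long as `k < 2ⁿ`, no truncation occurs in `k • 2⁻ⁿ + 2⁻ⁿ`. -/
lemma nsmul_halfPow_le_neg (n : ℕ) : ∀ k < 2 ^ n, k • halfPow A n ≤ neg (halfPow A n) := by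
  induction n with
  | zero =>
    intro k hk
    obtain rfl : k = 0 := by simpa using hk
    rw [zero_nsmul]
    exact zero_le
  | succ n ih =>
    have key : ∀ j < 2 ^ n, (2 * j + 1) • halfPow A (n + 1) ≤ neg (halfPow A (n + 1)) := by
      intro j hj
      have h1 : (2 * j) • halfPow A (n + 1) = j • halfPow A n := by
        rw [mul_nsmul', two_nsmul, halfPow_succ, ← nsmul_add, half_add_half]
      rw [add_nsmul, one_nsmul, h1, MVAlgebra.le_neg_comm, MVAlgebra.neg_add]
      calc halfPow A (n + 1) = halfPow A n - halfPow A (n + 1) := by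
            rw [halfPow_succ, sub_half]
        _ ≤ neg (j • halfPow A n) - halfPow A (n + 1) :=
            tsub_le_tsub_right (MVAlgebra.le_neg_comm.1 (ih j hj)) _
    intro k hk
    refine le_trans ?_ (key (k / 2) (by omega))
    exact nsmul_le_nsmul_left (zero_le) (by omega)

lemma neg_nsmul_halfPow {n k l : ℕ} (h : k + l = 2 ^ n) :
    neg (k • halfPow A n) = l • halfPow A n := by
  induction k generalizing l with
  | zero =>
    rw [zero_nsmul, MVAlgebra.neg_zero, ← Nat.zero_add l, h, two_pow_nsmul_halfPow_self]
  | succ k ih =>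
    rw [succ_nsmul, MVAlgebra.neg_add, ih (l := l + 1) (by omega), succ_nsmul, add_comm]
    exact MVAlgebra.add_sub_cancel_of_le_neg (nsmul_halfPow_le_neg n l (by omega))

lemma sub_nsmul_halfPow {n k : ℕ} (h : k < 2 ^ n) :
    (k + 1) • halfPow A n - k • halfPow A n = halfPow A n := by
  rw [succ_nsmul]
  exact MVAlgebra.add_sub_cancel_of_le_neg (MVAlgebra.le_neg_comm.1 (nsmul_halfPow_le_neg n k h))

end Halving

/-! ### Homomorphisms to the unit interval from prime ideals -/

section UnitInterval

open Filter Topology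

lemma eq_of_forall_abs_sub_le {a b C : ℝ} (h : ∀ n : ℕ, |a - b| ≤ C / 2 ^ n) : a = b := by
  have hlim : Tendsto (fun n : ℕ => C / (2 : ℝ) ^ n) atTop (𝓝 0) :=
    tendsto_const_nhds.div_atTop (tendsto_pow_atTop_atTop_of_one_lt one_lt_two)
  exact sub_eq_zero.1 (abs_nonpos_iff.1 (ge_of_tendsto' hlim h))

/-- If the remainders `tₙ` in `[0,1]` satisfy `tₙ = (uₙ + tₙ₊₁) / 2`, then `t₀ = δ(u₀, u₁, …)`. -/
lemma eq_coe_delta {u : ℕ → unitInterval} {t : ℕ → ℝ} (ht : ∀ n, t n ∈ unitInterval)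
    (h : ∀ n, t n = (u n : ℝ) / 2 + t (n + 1) / 2) : t 0 = (delta u : unitInterval) := by
  refine eq_of_forall_abs_sub_le (C := 1) fun n => ?_
  induction n generalizing u t with
  | zero =>
    rw [pow_zero, div_one, abs_le]
    have h1 := ht 0
    have h2 := (delta u).2
    constructor <;> linarith [h1.1, h1.2, h2.1, h2.2]
  | succ n ih =>
    rw [h 0, ← UnitIntervalDelta.seqCons_eta u, UnitIntervalDelta.coe_delta_cons,
      UnitIntervalDelta.seqCons_eta, add_sub_add_left_eq_sub, ← sub_div, abs_div, abs_two,
      pow_succ, ← div_div]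
    exact div_le_div_of_nonneg_right (ih (fun n => ht (n + 1)) fun n => h (n + 1)) zero_le_two

end UnitInterval

section Homs

variable {A : Type u} [DeltaOps A] [IsDeltaAlgebra A]

attribute [local instance] MVAlgebra.addCommMonoid MVAlgebra.sub MVAlgebra.lattice
  MVAlgebra.isOrderedAddMonoid MVAlgebra.canonicallyOrderedAdd MVAlgebra.orderedSub

/-- A homomorphism of MV-algebras from a δ-algebra to `[0,1]` preserves `δ`: it preserves `f`,
hence all the partial sums of the series that defines `δ` in `[0,1]`. -/
def homOfMVHom (φ : A → unitInterval) (hzero : φ MVOps.zero = MVOps.zero)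
    (hneg : ∀ x, φ (neg x) = neg (φ x))
    (hoplus : ∀ x y, φ (MVOps.oplus x y) = MVOps.oplus (φ x) (φ y)) :
    DeltaHom A unitInterval where
  toFun := φ
  map_zero := hzero
  map_neg := hneg
  map_oplus := hoplus
  map_delta x := by
    have hadd : ∀ x y : A, (φ (x + y) : ℝ) = min ((φ x : ℝ) + φ y) 1 := fun x y =>
      congrArg Subtype.val (hoplus x y)
    have hsub : ∀ x y : A, (φ (x - y) : ℝ) = max ((φ x : ℝ) - φ y) 0 := fun x y => by
      rw [← UnitIntervalDelta.coe_ominus]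
      change ((φ (MVOps.ominus x y) : unitInterval) : ℝ) = _
      simp only [MVOps.ominus, MVOps.odot, hneg, hoplus]
    have hhalf : ∀ x : A, (φ (half x) : ℝ) = φ x / 2 := fun x => by
      have h1 := hadd (half x) (half x)
      have h2 := hsub x (half x)
      rw [half_add_half] at h1
      rw [sub_half] at h2
      have h3 := (φ (half x)).2.1
      have h4 := (φ x).2.1
      rcases max_cases ((φ x : ℝ) - φ (half x)) 0 with h | h <;>
        rcases min_cases ((φ (half x) : ℝ) + φ (half x)) 1 with h' | h' <;> linarith
    have hdelta : ∀ x : ℕ → A,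
        (φ (delta x) : ℝ) = (φ (x 0) : ℝ) / 2 + (φ (delta fun n => x (n + 1)) : ℝ) / 2 :=
      fun x => by
        rw [delta_eq_half_add_half x, hadd, hhalf, hhalf, min_eq_left]
        linarith [(φ (x 0)).2.2, (φ (delta fun n => x (n + 1))).2.2]
    have h := eq_coe_delta (u := fun n => φ (x n)) (t := fun n => φ (delta fun i => x (n + i)))
      (fun n => (φ _).2) fun n => by
        simp only [hdelta fun i => x (n + i), Nat.add_zero, Nat.add_assoc, Nat.add_comm 1]
    simp only [Nat.zero_add] at h
    exact Subtype.ext h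

/-- The value at `x` of the homomorphism to `[0,1]` whose kernel consists of the elements that are
infinitesimal modulo the prime ideal `P`: the supremum of the dyadic rationals that are below `x` modulo `P`. -/
noncomputable def dyadicSup (P : Set A) (x : A) : ℝ :=
  sSup {r | ∃ n k : ℕ, k ≤ 2 ^ n ∧ r = k / 2 ^ n ∧ k • halfPow A n - x ∈ P}

lemma le_dyadicSup {P : Set A} {n k : ℕ} {x : A} (hk : k ≤ 2 ^ n)
    (h : k • halfPow A n - x ∈ P) : (k : ℝ) / 2 ^ n ≤ dyadicSup P x := by
  refine le_csSup ⟨1, ?_⟩ ⟨n, k, hk, rfl, h⟩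
  rintro _ ⟨n, k, hk, rfl, -⟩
  rw [div_le_one (by positivity)]
  exact_mod_cast hk

lemma sub_mem_trans {P : Set A} (hP : IsIdeal P) {x y z : A} (hxy : x - y ∈ P)
    (hyz : y - z ∈ P) : x - z ∈ P :=
  hP.mem_of_le tsub_le_tsub_add_tsub (hP.add_mem hxy hyz)

lemma add_sub_add_mem {P : Set A} (hP : IsIdeal P) {x y x' y' : A} (hx : x - x' ∈ P)
    (hy : y - y' ∈ P) : x + y - (x' + y') ∈ P :=
  hP.mem_of_le add_tsub_add_le_tsub_add_tsub (hP.add_mem hx hy)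

lemma sub_mem_of_le {P : Set A} (hP : IsIdeal P) {x y : A} (h : x ≤ y) : x - y ∈ P := by
  rw [tsub_eq_zero_of_le h]
  exact hP.zero_mem

lemma halfPow_notMem {P : Set A} (hP : IsIdeal P) (h1 : one ∉ P) (n : ℕ) : halfPow A n ∉ P := by
  intro h
  have h2 := hP.nsmul_mem h (2 ^ n)
  rw [two_pow_nsmul_halfPow_self] at h2
  exact h1 h2

lemma dyadicSup_le {P : Set A} (hP : IsIdeal P) (h1 : one ∉ P) {m l : ℕ} {x : A}
    (h : x - l • halfPow A m ∈ P) : dyadicSup P x ≤ l / 2 ^ m := by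
  refine csSup_le ⟨0, 0, 0, zero_le, by simp, ?_⟩ ?_
  · rw [zero_nsmul]
    exact sub_mem_of_le hP zero_le
  rintro _ ⟨n, k, hk, rfl, hkx⟩
  rw [div_le_div_iff₀ (by positivity) (by positivity)]
  by_contra! hlt
  have hlt' : l * 2 ^ n < k * 2 ^ m := by exact_mod_cast hlt
  refine halfPow_notMem hP h1 (n + m) (hP.mem_of_le ?_ (sub_mem_trans hP hkx h))
  have hN : k * 2 ^ m ≤ 2 ^ (n + m) := by rw [pow_add]; gcongr
  rw [← two_pow_nsmul_halfPow n m, ← two_pow_nsmul_halfPow m n, ← mul_nsmul', ← mul_nsmul',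
    add_comm m n]
  nth_rewrite 1 [← sub_nsmul_halfPow (hlt'.trans_le hN)]
  exact tsub_le_tsub_right (nsmul_le_nsmul_left (zero_le (a := halfPow A (n + m))) hlt') _

lemma exists_dyadic_bracket {P : Set A} (hP : IsIdeal P) (htot : ∀ x y : A, x - y ∈ P ∨ y - x ∈ P)
    (n : ℕ) (x : A) :
    ∃ k < 2 ^ n, k • halfPow A n - x ∈ P ∧ x - (k + 1) • halfPow A n ∈ P := by
  classical
  have h0 : (0 : ℕ) • halfPow A n - x ∈ P := by
    rw [zero_nsmul]
    exact sub_mem_of_le hP zero_le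
  set k := Nat.findGreatest (fun k => k • halfPow A n - x ∈ P) (2 ^ n - 1) with hk
  have hk1 : k • halfPow A n - x ∈ P :=
    Nat.findGreatest_spec (P := fun k => k • halfPow A n - x ∈ P) (Nat.zero_le _) h0
  have hk2 : k ≤ 2 ^ n - 1 := Nat.findGreatest_le _
  have hpos : 0 < 2 ^ n := by positivity
  refine ⟨k, by omega, hk1, ?_⟩
  rcases Nat.lt_or_ge k (2 ^ n - 1) with hlt | hge
  · exact (htot _ _).resolve_right
      (Nat.findGreatest_is_greatest (P := fun k => k • halfPow A n - x ∈ P) k.lt_succ_self hlt)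
  · rw [show k + 1 = 2 ^ n by omega, two_pow_nsmul_halfPow_self]
    exact sub_mem_of_le hP (MVAlgebra.le_one x)

/-- A proper prime ideal determines a homomorphism to `[0,1]`. -/
theorem exists_hom_of_prime {P : Set A} (hP : IsIdeal P) (h1 : one ∉ P)
    (htot : ∀ x y : A, x - y ∈ P ∨ y - x ∈ P) :
    ∃ φ : DeltaHom A unitInterval, ∀ x, (φ.toFun x : ℝ) = dyadicSup P x := by
  have hnonneg : ∀ x, 0 ≤ dyadicSup P x := fun x => by
    refine le_trans (by simp) (le_dyadicSup (P := P) (n := 0) (k := 0) zero_le ?_)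
    rw [zero_nsmul]
    exact sub_mem_of_le hP zero_le
  have hle : ∀ x, dyadicSup P x ≤ 1 := fun x => by
    refine (dyadicSup_le hP h1 (m := 0) (l := 1) ?_).trans (by simp)
    rw [one_nsmul]
    exact sub_mem_of_le hP (MVAlgebra.le_one x)
  refine ⟨homOfMVHom (fun x => ⟨dyadicSup P x, hnonneg x, hle x⟩) ?_ ?_ ?_, fun x => rfl⟩
  · refine Subtype.ext (le_antisymm ?_ (hnonneg _))
    refine (dyadicSup_le hP h1 (m := 0) (l := 0) ?_).trans (by simp; rfl)
    exact sub_mem_of_le hP (zero_le (a := (0 : ℕ) • halfPow A 0))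
  · intro x
    refine Subtype.ext (eq_of_forall_abs_sub_le (C := 1) fun n => ?_)
    change |dyadicSup P (neg x) - (1 - dyadicSup P x)| ≤ 1 / 2 ^ n
    obtain ⟨k, hk, hk1, hk2⟩ := exists_dyadic_bracket hP htot n x
    obtain ⟨l, hl⟩ : ∃ l, k + 1 + l = 2 ^ n := ⟨_, Nat.add_sub_of_le hk⟩
    have h3 := le_dyadicSup (by omega) hk1
    have h4 := dyadicSup_le hP h1 hk2
    have h5 : (l : ℝ) / 2 ^ n ≤ dyadicSup P (neg x) := by
      refine le_dyadicSup (by omega) ?_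
      rwa [← neg_nsmul_halfPow hl, MVAlgebra.neg_sub_neg]
    have h6 : dyadicSup P (neg x) ≤ ((l + 1 : ℕ) : ℝ) / 2 ^ n := by
      refine dyadicSup_le hP h1 ?_
      rwa [← neg_nsmul_halfPow (show k + (l + 1) = 2 ^ n by omega), MVAlgebra.neg_sub_neg]
    have h7 : ((k : ℝ) + 1 + l) / 2 ^ n = 1 := by
      rw [div_eq_one_iff_eq (by positivity)]
      exact_mod_cast hl
    push_cast at h4 h6
    rw [abs_le]
    simp only [add_div] at *
    constructor <;> linarith
  · intro x y
    refine Subtype.ext (eq_of_forall_abs_sub_le (C := 2) fun n => ?_)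
    change |dyadicSup P (x + y) - min (dyadicSup P x + dyadicSup P y) 1| ≤ 2 / 2 ^ n
    obtain ⟨k, hk, hk1, hk2⟩ := exists_dyadic_bracket hP htot n x
    obtain ⟨l, hl, hl1, hl2⟩ := exists_dyadic_bracket hP htot n y
    have h3 := le_dyadicSup hk.le hk1
    have h4 := dyadicSup_le hP h1 hk2
    have h5 := le_dyadicSup hl.le hl1
    have h6 := dyadicSup_le hP h1 hl2
    have h7 : dyadicSup P (x + y) ≤ ((k + 1 + (l + 1) : ℕ) : ℝ) / 2 ^ n := by
      refine dyadicSup_le hP h1 ?_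
      rw [add_nsmul]
      exact add_sub_add_mem hP hk2 hl2
    have h8 : min ((k : ℝ) / 2 ^ n + l / 2 ^ n) 1 ≤ dyadicSup P (x + y) := by
      have h9 : (k + l) • halfPow A n - (x + y) ∈ P := by
        rw [add_nsmul]
        exact add_sub_add_mem hP hk1 hl1
      rcases le_total (k + l) (2 ^ n) with hkl | hkl
      · refine (min_le_left _ _).trans ?_
        rw [← add_div]
        exact_mod_cast le_dyadicSup hkl h9
      · refine (min_le_right _ _).trans ?_
        have := le_dyadicSup (P := P) le_rfl
          (sub_mem_trans hP (sub_mem_of_le hP (nsmul_le_nsmul_left zero_le hkl)) h9)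
        push_cast at this
        rwa [div_self (by positivity)] at this
    have h9 := hle (x + y)
    have h10 : (0 : ℝ) < 1 / 2 ^ n := by positivity
    push_cast at h4 h6 h7
    have h11 : (2 : ℝ) / 2 ^ n = 1 / 2 ^ n + 1 / 2 ^ n := by ring
    simp only [add_div] at *
    rw [abs_le, h11]
    constructor
    · rcases min_cases ((k : ℝ) / 2 ^ n + l / 2 ^ n) 1 with h | h <;>
        rcases min_cases (dyadicSup P x + dyadicSup P y) 1 with h' | h' <;> linarith
    · rcases min_cases (dyadicSup P x + dyadicSup P y) 1 with h' | h' <;> linarith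

/-- A nonzero element `a` is detected by a homomorphism to `[0,1]`: as `a` is not infinitesimal,
there is a prime ideal that avoids `a ⊖ 2⁻ⁿ` for some `n`, hence contains `2⁻ⁿ ⊖ a`. -/
theorem exists_hom_pos {a : A} (ha : a ≠ 0) :
    ∃ φ : DeltaHom A unitInterval, 0 < (φ.toFun a : ℝ) := by
  obtain ⟨n, hn⟩ : ∃ n, ¬ a ≤ halfPow A n := by
    by_contra! h
    exact ha (eq_zero_of_forall_le_halfPow h)
  obtain ⟨P, hP, haP, htot⟩ := MVAlgebra.exists_prime_ideal (mt tsub_eq_zero_iff_le.1 hn)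
  obtain ⟨φ, hφ⟩ := exists_hom_of_prime hP
    (fun h => haP (hP.mem_of_le (MVAlgebra.le_one _) h)) htot
  refine ⟨φ, ?_⟩
  have h1 := (htot _ _).resolve_left haP
  rw [← one_nsmul (halfPow A n)] at h1
  rw [hφ]
  exact lt_of_lt_of_le (by positivity) (le_dyadicSup Nat.one_le_two_pow h1)

end Homs

/-! ### Values of homomorphisms, and separation of elements -/

section HomValues

variable {A : Type u} [DeltaOps A]

lemma coe_map_neg (φ : DeltaHom A unitInterval) (x : A) :
    (φ.toFun (neg x) : ℝ) = 1 - φ.toFun x := by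
  rw [φ.map_neg, UnitIntervalDelta.coe_neg]

lemma coe_map_oplus (φ : DeltaHom A unitInterval) (x y : A) :
    (φ.toFun (oplus x y) : ℝ) = min ((φ.toFun x : ℝ) + φ.toFun y) 1 := by
  rw [φ.map_oplus, UnitIntervalDelta.coe_oplus]

lemma coe_map_ominus (φ : DeltaHom A unitInterval) (x y : A) :
    (φ.toFun (ominus x y) : ℝ) = max ((φ.toFun x : ℝ) - φ.toFun y) 0 := by
  rw [← UnitIntervalDelta.coe_ominus]
  simp only [ominus, MVOps.odot, φ.map_neg, φ.map_oplus]

lemma coe_map_half (φ : DeltaHom A unitInterval) (x : A) :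
    (φ.toFun (half x) : ℝ) = φ.toFun x / 2 := by
  rw [← UnitIntervalDelta.coe_half, half, φ.map_delta, half]
  congr 3
  funext n
  cases n
  · rfl
  · exact φ.map_zero

lemma coe_map_halfPow (φ : DeltaHom A unitInterval) (n : ℕ) :
    (φ.toFun (halfPow A n) : ℝ) = 1 / 2 ^ n := by
  induction n with
  | zero =>
    change (φ.toFun (neg MVOps.zero) : ℝ) = _
    rw [coe_map_neg, φ.map_zero, UnitIntervalDelta.coe_zero]
    norm_num
  | succ n ih => rw [halfPow_succ, coe_map_half, ih, div_div, pow_succ]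

/-- The dyadic rationals of `[0,1]` are constants of every δ-algebra. -/
lemma exists_dyadic_const (A : Type u) [DeltaOps A] {n k : ℕ} (hk : k ≤ 2 ^ n) :
    ∃ c : A, ∀ φ : DeltaHom A unitInterval, (φ.toFun c : ℝ) = k / 2 ^ n := by
  induction k with
  | zero => exact ⟨MVOps.zero, fun φ => by rw [φ.map_zero, UnitIntervalDelta.coe_zero]; simp⟩
  | succ k ih =>
    obtain ⟨c, hc⟩ := ih (by omega)
    refine ⟨oplus c (halfPow A n), fun φ => ?_⟩
    rw [coe_map_oplus, hc, coe_map_halfPow, ← add_div, min_eq_left, Nat.cast_succ]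
    rw [div_le_one (by positivity)]
    exact_mod_cast hk

lemma exists_const_near (A : Type u) [DeltaOps A] {q ε : ℝ} (hq : q ∈ unitInterval)
    (hε : 0 < ε) : ∃ (c : A) (r : ℝ), |q - r| < ε ∧
      ∀ φ : DeltaHom A unitInterval, (φ.toFun c : ℝ) = r := by
  obtain ⟨n, hn⟩ := exists_pow_lt_of_lt_one hε (show (1 / 2 : ℝ) < 1 by norm_num)
  have hpow : (0 : ℝ) < 2 ^ n := by positivity
  have h1 : (⌊q * 2 ^ n⌋₊ : ℝ) ≤ q * 2 ^ n := Nat.floor_le (mul_nonneg hq.1 hpow.le)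
  have h2 : q * 2 ^ n < ⌊q * 2 ^ n⌋₊ + 1 := Nat.lt_floor_add_one _
  have hk : ⌊q * 2 ^ n⌋₊ ≤ 2 ^ n := by
    have : (⌊q * 2 ^ n⌋₊ : ℝ) ≤ 2 ^ n := h1.trans (mul_le_of_le_one_left hpow.le hq.2)
    exact_mod_cast this
  obtain ⟨c, hc⟩ := exists_dyadic_const A hk
  refine ⟨c, _, ?_, hc⟩
  have h3 : (⌊q * 2 ^ n⌋₊ : ℝ) / 2 ^ n ≤ q := (div_le_iff₀ hpow).2 h1
  have h4 : q < (⌊q * 2 ^ n⌋₊ + 1 : ℝ) / 2 ^ n := (lt_div_iff₀ hpow).2 h2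
  rw [one_div, inv_pow, ← one_div] at hn
  rw [add_div] at h4
  rw [abs_of_nonneg (by linarith)]
  linarith

lemma exists_const_between (A : Type u) [DeltaOps A] {s t : ℝ} (hs : 0 ≤ s) (hst : s < t)
    (ht : t ≤ 1) : ∃ (c : A) (r : ℝ), s < r ∧ r < t ∧
      ∀ φ : DeltaHom A unitInterval, (φ.toFun c : ℝ) = r := by
  obtain ⟨c, r, hr, hc⟩ := exists_const_near A (q := (s + t) / 2) (ε := (t - s) / 2)
    ⟨by linarith, by linarith⟩ (by linarith)
  rw [abs_lt] at hr
  exact ⟨c, r, by linarith [hr.2], by linarith [hr.1], hc⟩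

lemma exists_two_pow_mul (a : A) (m : ℕ) :
    ∃ b : A, ∀ φ : DeltaHom A unitInterval, (φ.toFun b : ℝ) = min (2 ^ m * (φ.toFun a : ℝ)) 1 := by
  induction m with
  | zero => exact ⟨a, fun φ => by rw [pow_zero, one_mul, min_eq_left (φ.toFun a).2.2]⟩
  | succ m ih =>
    obtain ⟨b, hb⟩ := ih
    refine ⟨oplus b b, fun φ => ?_⟩
    have h0 := mul_nonneg (pow_nonneg zero_le_two m) (φ.toFun a).2.1
    rw [coe_map_oplus, hb, pow_succ']
    rcases min_cases (2 ^ m * (φ.toFun a : ℝ)) 1 with h | h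
    · rw [h.1]
      congr 1
      ring
    · rw [h.1, min_eq_right (by norm_num), min_eq_right (by linarith)]

lemma exists_map_eq_max (a b : A) :
    ∃ c : A, ∀ φ : DeltaHom A unitInterval, (φ.toFun c : ℝ) = max (φ.toFun a : ℝ) (φ.toFun b) := by
  refine ⟨oplus (ominus a b) b, fun φ => ?_⟩
  rw [coe_map_oplus, coe_map_ominus, max_add, sub_add_cancel, zero_add]
  exact min_eq_left (max_le (φ.toFun a).2.2 (φ.toFun b).2.2)

lemma exists_map_eq_min (a b : A) :
    ∃ c : A, ∀ φ : DeltaHom A unitInterval, (φ.toFun c : ℝ) = min (φ.toFun a : ℝ) (φ.toFun b) := by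
  obtain ⟨c, hc⟩ := exists_map_eq_max (neg a) (neg b)
  refine ⟨neg c, fun φ => ?_⟩
  rw [coe_map_neg, hc, coe_map_neg, coe_map_neg, max_sub_sub_left, sub_sub_cancel]

/-- Distinct homomorphisms to `[0,1]` are separated by an element on which they take the values
`0` and `1`. -/
lemma exists_map_eq_zero_one {φ ψ : DeltaHom A unitInterval} (h : φ ≠ ψ) :
    ∃ a : A, (φ.toFun a : ℝ) = 0 ∧ (ψ.toFun a : ℝ) = 1 := by
  obtain ⟨a, ha⟩ : ∃ a : A, (φ.toFun a : ℝ) < ψ.toFun a := by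
    obtain ⟨a, ha⟩ : ∃ a, φ.toFun a ≠ ψ.toFun a := by
      by_contra! hcon
      exact h (DeltaHom.ext (funext hcon))
    rcases lt_or_gt_of_ne fun h' => ha (Subtype.ext h') with hlt | hlt
    · exact ⟨a, hlt⟩
    · refine ⟨neg a, ?_⟩
      rw [coe_map_neg, coe_map_neg]
      linarith
  obtain ⟨c, r, h1, h2, hc⟩ := exists_const_between A (φ.toFun a).2.1 ha (ψ.toFun a).2.2
  obtain ⟨m, hm⟩ := pow_unbounded_of_one_lt (1 / ((ψ.toFun a : ℝ) - r)) one_lt_two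
  obtain ⟨b, hb⟩ := exists_two_pow_mul (ominus a c) m
  refine ⟨b, ?_, ?_⟩
  · rw [hb, coe_map_ominus, hc, max_eq_right (by linarith)]
    simp
  · rw [hb, coe_map_ominus, hc, max_eq_left (by linarith)]
    exact min_eq_right ((div_lt_iff₀ (by linarith)).1 hm).le

end HomValues

section Separation

variable {A : Type u} [DeltaOps A] [IsDeltaAlgebra A]

attribute [local instance] MVAlgebra.addCommMonoid MVAlgebra.sub MVAlgebra.lattice
  MVAlgebra.isOrderedAddMonoid MVAlgebra.canonicallyOrderedAdd MVAlgebra.orderedSub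

/-- An element of a δ-algebra is determined by its values under the homomorphisms to `[0,1]`. -/
theorem eq_of_forall_hom_eq {a b : A}
    (h : ∀ φ : DeltaHom A unitInterval, φ.toFun a = φ.toFun b) : a = b := by
  have key : ∀ a b : A, (∀ φ : DeltaHom A unitInterval, φ.toFun a = φ.toFun b) → a ≤ b := by
    intro a b h
    by_contra hcon
    obtain ⟨φ, hφ⟩ := exists_hom_pos (mt tsub_eq_zero_iff_le.1 hcon)
    have h1 := coe_map_ominus φ a b
    rw [h φ, sub_self, max_self] at h1
    exact hφ.ne' h1
  exact le_antisymm (key a b h) (key b a fun φ => (h φ).symm)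

end Separation

/-! ### Density and surjectivity of evaluation; points as homomorphisms -/

section Approximation

variable {A : Type u} [DeltaOps A]

/-- A real function on the space of homomorphisms `A → [0,1]` is approximable if its truncation to
`[0,1]` is a uniform limit of evaluations at elements of `A`. The truncation makes the lattice
version of the Stone–Weierstrass theorem, which is about real functions, apply to `[0,1]`-valued
ones. -/
def IsApproximable (G : C(DeltaHom A unitInterval, ℝ)) : Prop :=
  ∀ ε > 0, ∃ a : A, ∀ φ : DeltaHom A unitInterval, |max 0 (min 1 (G φ)) - φ.toFun a| ≤ ε

lemma isApproximable_const (q : ℝ) :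
    IsApproximable (ContinuousMap.const (DeltaHom A unitInterval) q) := fun ε hε => by
  obtain ⟨c, r, hr, hc⟩ := exists_const_near A (q := max 0 (min 1 q))
    ⟨le_max_left _ _, max_le zero_le_one (min_le_left _ _)⟩ hε
  exact ⟨c, fun φ => by rw [hc]; exact hr.le⟩

lemma IsApproximable.sup {G H : C(DeltaHom A unitInterval, ℝ)} (hG : IsApproximable G)
    (hH : IsApproximable H) : IsApproximable (G ⊔ H) := fun ε hε => by
  obtain ⟨a, ha⟩ := hG ε hε
  obtain ⟨b, hb⟩ := hH ε hε
  obtain ⟨c, hc⟩ := exists_map_eq_max a b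
  refine ⟨c, fun φ => ?_⟩
  rw [hc, ContinuousMap.sup_apply, min_max_distrib_left, sup_sup_distrib_left]
  exact (abs_max_sub_max_le_max _ _ _ _).trans (max_le (ha φ) (hb φ))

lemma IsApproximable.inf {G H : C(DeltaHom A unitInterval, ℝ)} (hG : IsApproximable G)
    (hH : IsApproximable H) : IsApproximable (G ⊓ H) := fun ε hε => by
  obtain ⟨a, ha⟩ := hG ε hε
  obtain ⟨b, hb⟩ := hH ε hε
  obtain ⟨c, hc⟩ := exists_map_eq_min a b
  refine ⟨c, fun φ => ?_⟩
  rw [hc, ContinuousMap.inf_apply, inf_inf_distrib_left, max_min_distrib_left]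
  exact (abs_min_sub_min_le_max _ _ _ _).trans (max_le (ha φ) (hb φ))

/-- Evaluation at an element of `A`, as a real function. -/
def evalReal (a : A) : C(DeltaHom A unitInterval, ℝ) :=
  ⟨fun φ => φ.toFun a, continuous_subtype_val.comp (DeltaHom.continuous_eval a)⟩

lemma isApproximable_affine (a : A) {m k : ℕ} (hk : k ≤ 2 ^ m) :
    IsApproximable ((2 ^ m : ℝ) • evalReal a - ContinuousMap.const _ (k : ℝ)) := fun ε hε => by
  obtain ⟨c, hc⟩ := exists_dyadic_const A hk
  obtain ⟨b, hb⟩ := exists_two_pow_mul (ominus a c) m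
  refine ⟨b, fun φ => ?_⟩
  have h1 : (2 : ℝ) ^ m * max ((φ.toFun a : ℝ) - k / 2 ^ m) 0 =
      max (2 ^ m * (φ.toFun a : ℝ) - k) 0 := by
    rw [mul_max_of_nonneg _ _ (by positivity), mul_zero, mul_sub, mul_div_cancel₀ _ (by positivity)]
  rw [hb, coe_map_ominus, hc, h1]
  change |max 0 (min 1 (2 ^ m * (φ.toFun a : ℝ) - k)) - _| ≤ ε
  rw [max_min_distrib_left, max_eq_right zero_le_one, max_comm, min_comm, sub_self, abs_zero]
  exact hε.le

lemma separatesPointsStrongly_isApproximable :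
    Set.SeparatesPointsStrongly {G : C(DeltaHom A unitInterval, ℝ) | IsApproximable G} := by
  intro v φ ψ
  rcases eq_or_ne φ ψ with rfl | hne
  · exact ⟨_, isApproximable_const (v φ), rfl, rfl⟩
  obtain ⟨b, hb0, hb1⟩ := exists_map_eq_zero_one hne
  -- `k` and `2 ^ m - k` exceed the absolute values of the targets, so that the two affine
  -- functions below are negligible at one of the two points and dominate at the other.
  obtain ⟨k, hk⟩ := exists_nat_ge (max |v φ| |v ψ|)
  obtain ⟨hkφ, hkψ⟩ := max_le_iff.1 hk
  rw [abs_le] at hkφ hkψ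
  have hm : 2 * k ≤ 2 ^ (2 * k) := Nat.lt_two_pow_self.le
  have hm' : (2 : ℝ) * k ≤ 2 ^ (2 * k) := by exact_mod_cast hm
  have haff : ∀ a : A, IsApproximable
      ((2 ^ (2 * k) : ℝ) • evalReal a - ContinuousMap.const _ (k : ℝ)) := fun a =>
    isApproximable_affine a (by omega)
  refine ⟨_, ((isApproximable_const (v ψ)).inf (haff b)).sup
    ((isApproximable_const (v φ)).inf (haff (neg b))), ?_, ?_⟩
  · change max (min (v ψ) (2 ^ (2 * k) * (φ.toFun b : ℝ) - k))
      (min (v φ) (2 ^ (2 * k) * (φ.toFun (neg b) : ℝ) - k)) = v φ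
    rw [coe_map_neg, hb0, min_eq_right (by linarith), min_eq_left (by linarith),
      max_eq_right (by linarith)]
  · change max (min (v ψ) (2 ^ (2 * k) * (ψ.toFun b : ℝ) - k))
      (min (v φ) (2 ^ (2 * k) * (ψ.toFun (neg b) : ℝ) - k)) = v ψ
    rw [coe_map_neg, hb1, min_eq_left (by linarith), min_eq_right (by linarith),
      max_eq_left (by linarith)]

/-- The evaluations at elements of `A` are dense in the continuous functions to `[0,1]`. -/
theorem exists_forall_abs_sub_le (g : C(DeltaHom A unitInterval, unitInterval)) {ε : ℝ}
    (hε : 0 < ε) : ∃ a : A, ∀ φ : DeltaHom A unitInterval, |(g φ : ℝ) - φ.toFun a| ≤ ε := by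
  have htop := ContinuousMap.sublattice_closure_eq_top
    {G : C(DeltaHom A unitInterval, ℝ) | IsApproximable G} ⟨_, isApproximable_const 0⟩
    (fun G hG H hH => IsApproximable.inf hG hH) (fun G hG H hH => IsApproximable.sup hG hH)
    separatesPointsStrongly_isApproximable
  set g' : C(DeltaHom A unitInterval, ℝ) :=
    ⟨fun φ => (g φ : ℝ), continuous_subtype_val.comp g.continuous⟩ with hg'
  have hmem : g' ∈ closure {G : C(DeltaHom A unitInterval, ℝ) | IsApproximable G} := by
    rw [htop]; trivial
  obtain ⟨G, hG, hdist⟩ := Metric.mem_closure_iff.1 hmem (ε / 2) (half_pos hε)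
  obtain ⟨a, ha⟩ := hG (ε / 2) (half_pos hε)
  refine ⟨a, fun φ => ?_⟩
  have h1 : |(g φ : ℝ) - G φ| ≤ ε / 2 := (ContinuousMap.dist_apply_le_dist φ).trans hdist.le
  have h2 : |(g φ : ℝ) - max 0 (min 1 (G φ))| ≤ ε / 2 := by
    have h3 : (g φ : ℝ) = max 0 (min 1 (g φ : ℝ)) := by
      rw [min_eq_right (g φ).2.2, max_eq_right (g φ).2.1]
    rw [h3]
    refine (abs_max_sub_max_le_max _ _ _ _).trans (max_le (by simpa using (half_pos hε).le) ?_)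
    exact (abs_min_sub_min_le_max _ _ _ _).trans (max_le (by simpa using (half_pos hε).le) h1)
  linarith [abs_sub_le (g φ : ℝ) (max 0 (min 1 (G φ))) (φ.toFun a), ha φ]

/-- A first binary digit `u` in `A` of a continuous function `g`, with the remainder `2 g - u`. -/
lemma exists_digit (g : C(DeltaHom A unitInterval, unitInterval)) :
    ∃ (u : A) (g' : C(DeltaHom A unitInterval, unitInterval)),
      ∀ φ, (g φ : ℝ) = (φ.toFun u : ℝ) / 2 + g' φ / 2 := by
  obtain ⟨s, hs⟩ := exists_forall_abs_sub_le g (show (0 : ℝ) < 1 / 8 by norm_num)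
  obtain ⟨q, hq⟩ := exists_dyadic_const A (n := 2) (k := 1) (by norm_num)
  -- The digit is the truncation of `2 s - 1/2`, where `s` is close to `g`.
  set u := oplus (ominus s q) (ominus s q) with hu
  have hval : ∀ φ : DeltaHom A unitInterval,
      (φ.toFun u : ℝ) = min (max ((φ.toFun s : ℝ) - 1 / 4) 0 + max ((φ.toFun s : ℝ) - 1 / 4) 0) 1 :=
    fun φ => by
      rw [hu, coe_map_oplus, coe_map_ominus, hq]
      norm_num
  refine ⟨u, ⟨fun φ => ⟨2 * (g φ : ℝ) - φ.toFun u, ?_, ?_⟩, ?_⟩, fun φ => ?_⟩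
  · have h1 := abs_le.1 (hs φ)
    have h2 := (g φ).2.1
    rw [hval]
    rcases max_cases ((φ.toFun s : ℝ) - 1 / 4) 0 with h | h <;>
      rcases min_cases (max ((φ.toFun s : ℝ) - 1 / 4) 0 + max ((φ.toFun s : ℝ) - 1 / 4) 0) 1
        with h' | h' <;> linarith
  · have h1 := abs_le.1 (hs φ)
    have h2 := (g φ).2.2
    rw [hval]
    rcases max_cases ((φ.toFun s : ℝ) - 1 / 4) 0 with h | h <;>
      rcases min_cases (max ((φ.toFun s : ℝ) - 1 / 4) 0 + max ((φ.toFun s : ℝ) - 1 / 4) 0) 1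
        with h' | h' <;> linarith
  · exact Continuous.subtype_mk ((continuous_const.mul (continuous_subtype_val.comp
      g.continuous)).sub (continuous_subtype_val.comp (DeltaHom.continuous_eval u))) _
  · change (g φ : ℝ) = _ / 2 + (2 * (g φ : ℝ) - φ.toFun u) / 2
    ring

end Approximation

section Evaluation

/-- The homomorphism from `A` to the continuous functions on its space of homomorphisms to
`[0,1]`. -/
noncomputable def evalDeltaHom (A : Type u) [DeltaOps A] :
    DeltaHom A C(DeltaHom A unitInterval, unitInterval) where
  toFun a := ⟨fun φ => φ.toFun a, DeltaHom.continuous_eval a⟩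
  map_zero := ContinuousMap.ext fun φ => φ.map_zero
  map_neg x := ContinuousMap.ext fun φ => φ.map_neg x
  map_oplus x y := ContinuousMap.ext fun φ => φ.map_oplus x y
  map_delta x := ContinuousMap.ext fun φ => φ.map_delta x

lemma evalDeltaHom_injective (A : Type u) [DeltaOps A] [IsDeltaAlgebra A] :
    Function.Injective (evalDeltaHom A).toFun := fun _ _ h =>
  eq_of_forall_hom_eq fun φ => DFunLike.congr_fun h φ

/-- Every continuous function is `δ` of the sequence of its digits. -/
theorem evalDeltaHom_surjective (A : Type u) [DeltaOps A] :
    Function.Surjective (evalDeltaHom A).toFun := by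
  intro g
  choose digit rem hrem using exists_digit (A := A)
  refine ⟨delta fun n => digit (rem^[n] g), ContinuousMap.ext fun φ => Subtype.ext ?_⟩
  change ((φ.toFun (delta fun n => digit (rem^[n] g)) : unitInterval) : ℝ) = _
  rw [φ.map_delta]
  refine (eq_coe_delta (t := fun n => ((rem^[n] g) φ : ℝ)) (fun n => (_ : unitInterval).2)
    fun n => ?_).symm
  rw [Function.iterate_succ_apply']
  exact hrem _ φ

/-- Evaluation of continuous functions at a point. -/
noncomputable def pointHom {X : Type u} [TopologicalSpace X] (x : X) :
    DeltaHom C(X, unitInterval) unitInterval where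
  toFun f := f x
  map_zero := rfl
  map_neg _ := rfl
  map_oplus _ _ := rfl
  map_delta _ := rfl

/-- Points of `X` as homomorphisms `C(X, [0,1]) → [0,1]`. -/
noncomputable def pointHomMap (X : Type u) [TopologicalSpace X] :
    C(X, DeltaHom C(X, unitInterval) unitInterval) :=
  ⟨pointHom, DeltaHom.isInducing_toFun.continuous_iff.2 (continuous_pi fun f => f.continuous)⟩

lemma pointHomMap_injective (X : Type u) [TopologicalSpace X] [CompactSpace X] [T2Space X] :
    Function.Injective (pointHomMap X) := by
  intro x y hxy
  by_contra hne
  obtain ⟨f, hf0, hf1, hf⟩ := exists_continuous_zero_one_of_isClosed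
    (isClosed_singleton (x := x)) (isClosed_singleton (x := y)) (Set.disjoint_singleton.2 hne)
  have h : (⟨fun z => ⟨f z, hf z⟩, f.continuous.subtype_mk _⟩ : C(X, unitInterval)) x =
      (⟨fun z => ⟨f z, hf z⟩, f.continuous.subtype_mk _⟩ : C(X, unitInterval)) y :=
    congrFun (congrArg DeltaHom.toFun hxy) _
  have h' : f x = f y := congrArg Subtype.val h
  rw [hf0 rfl, hf1 rfl] at h'
  exact zero_ne_one h'

/-- A function without zeros on a compact space is bounded below by a positive constant, so it is
not in the kernel of any homomorphism. -/
lemma exists_eq_zero_of_map_eq_zero {X : Type u} [TopologicalSpace X] [CompactSpace X]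
    (φ : DeltaHom C(X, unitInterval) unitInterval) {k : C(X, unitInterval)}
    (hk : (φ.toFun k : ℝ) = 0) : ∃ x, (k x : ℝ) = 0 := by
  by_contra! hne
  obtain ⟨ε, hε, hle⟩ := isCompact_univ.exists_forall_le' (f := fun x => (k x : ℝ)) (a := 0)
    (continuous_subtype_val.comp k.continuous).continuousOn
    fun x _ => lt_of_le_of_ne (k x).2.1 (hne x).symm
  obtain ⟨c, r, h0, h1, hc⟩ := exists_const_between C(X, unitInterval) le_rfl
    (lt_min hε one_pos) (min_le_right _ _)
  have hzero : ominus c k = MVOps.zero := ContinuousMap.ext fun x => Subtype.ext <| by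
    have h2 := coe_map_ominus (pointHom x) c k
    rw [hc] at h2
    refine h2.trans (max_eq_right (sub_nonpos.2 ?_))
    exact (h1.le.trans (min_le_left _ _)).trans (hle x trivial)
  have h2 := coe_map_ominus φ c k
  rw [hzero, φ.map_zero, hc, hk, sub_zero, UnitIntervalDelta.coe_zero, max_eq_left h0.le] at h2
  exact h0.ne h2

/-- The zero sets of the functions in the kernel of a homomorphism have a common point. -/
theorem pointHomMap_surjective (X : Type u) [TopologicalSpace X] [CompactSpace X] :
    Function.Surjective (pointHomMap X) := by
  intro φ
  let Z : {k : C(X, unitInterval) // (φ.toFun k : ℝ) = 0} → Set X := fun k => {x | (k.1 x : ℝ) = 0}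
  have : Nonempty {k : C(X, unitInterval) // (φ.toFun k : ℝ) = 0} :=
    ⟨⟨MVOps.zero, by rw [φ.map_zero, UnitIntervalDelta.coe_zero]⟩⟩
  have hclosed : ∀ k, IsClosed (Z k) := fun k =>
    isClosed_eq (continuous_subtype_val.comp k.1.continuous) continuous_const
  obtain ⟨x, hx⟩ := IsCompact.nonempty_iInter_of_directed_nonempty_isCompact_isClosed Z
    (fun k l => by
      refine ⟨⟨oplus k.1 l.1, ?_⟩, fun x hx => ?_, fun x hx => ?_⟩
      · rw [coe_map_oplus, k.2, l.2, add_zero, min_eq_left zero_le_one]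
      all_goals
        have h1 : min ((k.1 x : ℝ) + l.1 x) 1 = 0 := hx
        have h2 := (k.1 x).2.1
        have h3 := (l.1 x).2.1
        rcases min_cases ((k.1 x : ℝ) + l.1 x) 1 with h | h
      · exact le_antisymm (by linarith) h2
      · linarith
      · exact le_antisymm (by linarith) h3
      · linarith)
    (fun k => exists_eq_zero_of_map_eq_zero φ k.2) (fun k => (hclosed k).isCompact) hclosed
  have hker : ∀ k : C(X, unitInterval), (φ.toFun k : ℝ) = 0 → (k x : ℝ) = 0 := fun k hk =>
    Set.mem_iInter.1 hx ⟨k, hk⟩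
  have hle : ∀ k : C(X, unitInterval), (k x : ℝ) ≤ φ.toFun k := fun k => by
    by_contra! hlt
    obtain ⟨c, r, h1, h2, hc⟩ := exists_const_between C(X, unitInterval) (φ.toFun k).2.1 hlt
      (k x).2.2
    have h3 := hker (ominus k c) (by
      rw [coe_map_ominus, hc, max_eq_right (by linarith)])
    have h4 : ((ominus k c) x : ℝ) = max ((k x : ℝ) - _) 0 := coe_map_ominus (pointHom x) k c
    rw [h3, hc, max_eq_left (by linarith)] at h4
    linarith
  refine ⟨x, DeltaHom.ext (funext fun k => Subtype.ext (le_antisymm (hle k) ?_))⟩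
  have h1 := hle (neg k)
  have h2 : ((neg k) x : ℝ) = 1 - k x := coe_map_neg (pointHom x) k
  rw [coe_map_neg, h2] at h1
  change (φ.toFun k : ℝ) ≤ k x
  linarith

end Evaluation

/-! ### The duality and the equations -/

section Duality

/-- A bijective homomorphism is an isomorphism of δ-algebras. -/
noncomputable def isoOfBijective {A B : DeltaAlg.{u}} (f : DeltaHom A.carrier B.carrier)
    (hf : Function.Bijective f.toFun) : A ≅ B :=
  let e := Equiv.ofBijective f.toFun hf
  have he : ∀ y, f.toFun (e.symm y) = y := e.apply_symm_apply
  { hom := f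
    inv :=
      { toFun := e.symm
        map_zero := hf.1 <| by rw [he, f.map_zero]
        map_neg := fun x => hf.1 <| by rw [he, f.map_neg, he]
        map_oplus := fun x y => hf.1 <| by rw [he, f.map_oplus, he, he]
        map_delta := fun x => hf.1 <| by simp only [he, f.map_delta] }
    hom_inv_id := DeltaHom.ext (funext fun x => e.symm_apply_apply x)
    inv_hom_id := DeltaHom.ext (funext he) }

/-- The unit of the duality: points of a compact Hausdorff space as homomorphisms. -/
noncomputable def unitNatIso : 𝟭 CompHaus.{u}ᵒᵖ ≅ homKH ⋙ homVA.rightOp :=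
  (NatIso.ofComponents (fun X => (CompHausLike.isoOfBijective
    (CompHausLike.ofHom _ (pointHomMap X.unop) :
      X.unop ⟶ CompHaus.of (DeltaHom C(X.unop, unitInterval) unitInterval))
    ⟨pointHomMap_injective X.unop, pointHomMap_surjective X.unop⟩).op)
    fun _ => Quiver.Hom.unop_inj rfl).symm

/-- The counit of the duality: elements of a δ-algebra as continuous functions. -/
noncomputable def counitNatIso : homVA.rightOp ⋙ homKH ≅ 𝟭 DeltaAlg.{u} :=
  (NatIso.ofComponents (fun A => isoOfBijective (B := homKH.obj (homVA.rightOp.obj A))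
    (evalDeltaHom A.carrier) ⟨evalDeltaHom_injective A.carrier, evalDeltaHom_surjective A.carrier⟩)
    fun _ => rfl).symm

end Duality

section Equations

namespace Term

/-- The term `1`. -/
def one : DeltaTerm := .neg .zero

/-- The term `s ⊖ t`. -/
def ominus (s t : DeltaTerm) : DeltaTerm := .neg (.oplus (.neg s) (.neg (.neg t)))

/-- The term `d(s, t)`. -/
def dist (s t : DeltaTerm) : DeltaTerm := .oplus (ominus s t) (ominus t s)

/-- The term `f(s) = δ(s, 0, 0, …)`. -/
def half (s : DeltaTerm) : DeltaTerm := .delta (seqCons s fun _ => .zero)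

variable {A : Type u} [DeltaOps A] (ρ : ℕ → A)

lemma eval_delta_seqCons (s : DeltaTerm) (t : ℕ → DeltaTerm) :
    (DeltaTerm.delta (seqCons s t)).eval ρ = delta (seqCons (s.eval ρ) fun n => (t n).eval ρ) :=
  congrArg delta (funext fun n => by cases n <;> rfl)

lemma eval_half (s : DeltaTerm) : (half s).eval ρ = DeltaOps.half (s.eval ρ) :=
  eval_delta_seqCons ρ _ _

lemma eval_dist (s t : DeltaTerm) :
    (dist s t).eval ρ = MVOps.dist (s.eval ρ) (t.eval ρ) := rfl

lemma eval_ominus (s t : DeltaTerm) :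
    (ominus s t).eval ρ = MVOps.ominus (s.eval ρ) (t.eval ρ) := rfl

end Term

open DeltaTerm in
/-- The equations of MV-algebras followed by A1 to A6. In A5, the two sequences of variables are the
even-numbered and the odd-numbered ones. -/
def axiomEquations : Set (DeltaTerm × DeltaTerm) :=
  {(neg (neg (var 0)), var 0),
    (oplus (oplus (var 0) (var 1)) (var 2), oplus (var 0) (oplus (var 1) (var 2))),
    (oplus (var 0) (var 1), oplus (var 1) (var 0)),
    (oplus (var 0) zero, var 0),
    (oplus (var 0) Term.one, Term.one),
    (oplus (neg (oplus (neg (var 0)) (var 1))) (var 1),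
      oplus (neg (oplus (neg (var 1)) (var 0))) (var 0)),
    (Term.dist (delta var) (Term.half (var 0)), delta (seqCons zero fun n => var (n + 1))),
    (Term.half (delta var), delta fun n => Term.half (var n)),
    (delta fun _ => var 0, var 0),
    (delta (seqCons zero var), Term.half (delta var)),
    (oplus (neg (delta fun n => var (2 * n)))
      (delta fun n => oplus (var (2 * n)) (var (2 * n + 1))), Term.one),
    (Term.half (Term.ominus (var 0) (var 1)), Term.ominus (Term.half (var 0)) (Term.half (var 1)))}

lemma finite_axiomEquations : axiomEquations.Finite := by
  rw [axiomEquations]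
  exact Set.toFinite _

theorem isDeltaAlgebra_iff_satisfiesEquations (A : Type u) [DeltaOps A] :
    IsDeltaAlgebra A ↔ SatisfiesEquations A axiomEquations := by
  simp only [SatisfiesEquations, axiomEquations, Set.mem_insert_iff, Set.mem_singleton_iff,
    forall_eq_or_imp, forall_eq, Term.eval_delta_seqCons]
  simp only [Term.eval_half, Term.eval_dist, Term.eval_ominus, DeltaTerm.eval, Term.one]
  constructor
  · intro h
    exact ⟨fun ρ => h.neg_neg _, fun ρ => h.oplus_assoc _ _ _, fun ρ => h.oplus_comm _ _,
      fun ρ => h.oplus_zero _, fun ρ => h.oplus_one _, fun ρ => h.mv_law _ _, fun ρ => h.a1 ρ,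
      fun ρ => h.a2 ρ, fun ρ => h.a3 _, fun ρ => h.a4 ρ, fun ρ => h.a5 _ _, fun ρ => h.a6 _ _⟩
  · rintro ⟨h1, h2, h3, h4, h5, h6, h7, h8, h9, h10, h11, h12⟩
    exact
      { neg_neg := fun x => h1 fun _ => x
        oplus_assoc := fun x y z => h2 (seqCons x (seqCons y fun _ => z))
        oplus_comm := fun x y => h3 (seqCons x fun _ => y)
        oplus_zero := fun x => h4 fun _ => x
        oplus_one := fun x => h5 fun _ => x
        mv_law := fun x y => h6 (seqCons x fun _ => y)
        a1 := h7
        a2 := h8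
        a3 := fun x => h9 fun _ => x
        a4 := h10
        a5 := fun x y => by
          have h := h11 fun n => if Even n then x (n / 2) else y (n / 2)
          have hodd : ∀ n, (2 * n + 1) / 2 = n := fun n => by omega
          simpa [hodd, MVOps.le, MVOps.one] using h
        a6 := fun x y => h12 (seqCons x fun _ => y) }

end Equations

end DeltaAlgebra

/-- The contravariant functors `hom(-, [0,1])` between compact Hausdorff spaces and δ-algebras
form a dual equivalence, and δ-algebras are axiomatised by finitely many equations. -/
theorem theorem8p2 :
    (∃ e : CompHaus.{u}ᵒᵖ ≌ DeltaAlg.{u}, e.functor = homKH ∧ e.inverse = homVA.rightOp) ∧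
    (∃ E : Set (DeltaTerm × DeltaTerm), E.Finite ∧
      ∀ (A : Type u) [DeltaOps A], IsDeltaAlgebra A ↔ SatisfiesEquations A E) :=
  ⟨⟨.mk homKH homVA.rightOp DeltaAlgebra.unitNatIso DeltaAlgebra.counitNatIso, rfl, rfl⟩,
    DeltaAlgebra.axiomEquations, DeltaAlgebra.finite_axiomEquations,
    DeltaAlgebra.isDeltaAlgebra_iff_satisfiesEquations⟩
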